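/- Let $K$ be a field of characteristic $0$ and let $\Lambda=K[p_1,p_2,\ldots]$ be the algebra of symmetric functions over $K$, written as polynomials in the power sums $p_i$. Let $p_i^{\perp}=i\,\frac{\partial}{\partial p_i}$, and for a partition $\alpha=(\alpha_1,\ldots,\alpha_l)$ with $l(\alpha)=l$ parts put $p_\alpha=p_{\alpha_1}\cdots p_{\alpha_l}$ and $p^{\perp}_\alpha=p^{\perp}_{\alpha_1}\cdots p^{\perp}_{\alpha_l}$. Let $s_\lambda\in\Lambda$ denote the Schur functions. There are unique linear operators $\mathcal U_k$ ($k\ge 0$) on $\Lambda$ with $$\mathcal U_k\, s_\lambda=\sum_{\mu=\lambda+\Box} c(\Box)^k\, s_\mu\qquad\text{for all partitions }\lambda,$$ where the sum is over all partitions $\mu$ whose diagram is obtained from that of $\lambda$ by adding one cell $\Box$, and $c(\Box)=j-i$ is the content of the cell $\Box$ in row $i$ and column $j$ (with $0^0=1$). Every linear operator on $\Lambda$ has a unique expansion $\sum_{\gamma,\alpha}c(\gamma,\alpha)\,p_\gamma p_\alpha^{\perp}$ with scalars $c(\gamma,\alpha)$, where for each $\alpha$ only finitely many $c(\gamma,\alpha)$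 are nonzero. For $h\ge 0$, let $\mathcal U_k^{(h)}$ be the sum of those terms in the expansion of $\mathcal U_k$ that have $l(\gamma)+l(\alpha)=k+1-2h$. Then $\mathcal U_0^{(0)}=p_1$ (the operator of multiplication by $p_1$), and for every $k\ge 1$ $$\mathcal U_k^{(0)}=\sum_{j=1}^{k}\frac{1}{k+1}\binom{k+1}{j}\sum p_{a_1}\cdots p_{a_j}\,p^{\perp}_{b_1}\cdots p^{\perp}_{b_{k+1-j}},$$ where the inner sum ranges over all tuples of positive integers $a_1,\ldots,a_j,b_1,\ldots,b_{k+1-j}$ with $a_1+\cdots+a_j=b_1+\cdots+b_{k+1-j}+1$. -/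

import Mathlib

namespace ContentOps

open MvPolynomial

/-! ### Symmetric functions as polynomials in the power sums -/

/-- The algebra of symmetric functions over a field `K` of characteristic zero, written as the
polynomial algebra `K[p₁, p₂, …]` in the power sums; `X i` is the power sum `p_i`. -/
abbrev SymFun (K : Type*) [Field K] : Type _ := MvPolynomial ℕ+ K

/-- A partition `1^{m₁} 2^{m₂} ⋯`, given by its multiplicities `m_i`. The number of its parts is
`Finsupp.degree α`, and `p_α` is `monomial α 1`. -/
abbrev Part : Type := ℕ+ →₀ ℕ

/-- The complete symmetric functions `h_n`, in terms of the power sums: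
`h_0 = 1` and `n h_n = p_1 h_{n-1} + p_2 h_{n-2} + ⋯ + p_n h_0`. -/
noncomputable def complete (K : Type*) [Field K] : ℕ → SymFun K
  | 0 => 1
  | n + 1 => C ((n + 1 : K)⁻¹) *
      ∑ i : Fin (n + 1), X (Nat.succPNat i) * complete K (n - i)

/-- `h_n` for an integer index, with `h_n = 0` for `n < 0`. -/
noncomputable def completeInt (K : Type*) [Field K] (n : ℤ) : SymFun K :=
  if 0 ≤ n then complete K n.toNat else 0

/-- The Schur function `s_λ = det (h_{λ_i - i + j})` in terms of the power sums. The row index,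
the column index and the rows of `λ` are all numbered from `0`. -/
noncomputable def schur (K : Type*) [Field K] (lam : YoungDiagram) : SymFun K :=
  Matrix.det (Matrix.of fun i j : Fin (lam.colLen 0) =>
    completeInt K ((lam.rowLen i : ℤ) - (i : ℤ) + (j : ℤ)))

/-! ### Adding a cell to a partition -/

/-- The positions `□` outside `λ` such that `λ + □` is again the diagram of a partition. -/
noncomputable def addable (lam : YoungDiagram) : Finset (ℕ × ℕ) :=
  open Classical in
  (Finset.range (lam.card + 1) ×ˢ Finset.range (lam.card + 1)).filter fun b =>
    b ∉ lam ∧ IsLowerSet ((insert b lam.cells : Finset (ℕ × ℕ)) : Set (ℕ × ℕ))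

/-- The bounding box in the definition of `addable` excludes nothing. -/
theorem mem_addable (lam : YoungDiagram) (b : ℕ × ℕ) :
    b ∈ addable lam ↔
      b ∉ lam ∧ IsLowerSet ((insert b lam.cells : Finset (ℕ × ℕ)) : Set (ℕ × ℕ)) := by
  classical
  unfold addable
  simp only [Finset.mem_filter, Finset.mem_product, Finset.mem_range, and_iff_right_iff_imp]
  rintro ⟨-, h⟩
  obtain ⟨i, j⟩ := b
  have key : ∀ i' j', i' ≤ i → j' ≤ j → (i', j') ≠ (i, j) → (i', j') ∈ lam.cells := by
    intro i' j' hi hj hne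
    have h1 : (i', j') ∈ ((insert (i, j) lam.cells : Finset (ℕ × ℕ)) : Set (ℕ × ℕ)) :=
      h (a := (i, j)) (Prod.mk_le_mk.mpr ⟨hi, hj⟩) (by simp)
    rcases Finset.mem_insert.mp (Finset.mem_coe.mp h1) with h2 | h2
    · exact absurd h2 hne
    · exact h2
  constructor
  · have hsub : (Finset.range i).image (fun t => (t, j)) ⊆ lam.cells := by
      intro x hx
      obtain ⟨t, ht, rfl⟩ := Finset.mem_image.mp hx
      have ht' := Finset.mem_range.mp ht
      exact key t j ht'.le le_rfl (by simp; omega)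
    have := Finset.card_le_card hsub
    rw [Finset.card_image_of_injective _ (fun a b h => (Prod.mk.inj h).1),
      Finset.card_range] at this
    exact Nat.lt_succ_of_le this
  · have hsub : (Finset.range j).image (fun t => (i, t)) ⊆ lam.cells := by
      intro x hx
      obtain ⟨t, ht, rfl⟩ := Finset.mem_image.mp hx
      have ht' := Finset.mem_range.mp ht
      exact key i t le_rfl ht'.le (by simp; omega)
    have := Finset.card_le_card hsub
    rw [Finset.card_image_of_injective _ (fun a b h => (Prod.mk.inj h).2),
      Finset.card_range] at this
    exact Nat.lt_succ_of_le this

/-- The partition `λ + □`. -/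
noncomputable def addCell (lam : YoungDiagram) (b : ℕ × ℕ) (hb : b ∈ addable lam) : YoungDiagram :=
  ⟨insert b lam.cells, ((mem_addable lam b).mp hb).2⟩

/-- The content `c(□) = j - i` of the cell `□ = (i, j)` in row `i` and column `j`. -/
def content (b : ℕ × ℕ) : ℤ := (b.2 : ℤ) - (b.1 : ℤ)

/-- The family of linear operators `U_k`, `k ≥ 0`, has the prescribed action
`U_k s_λ = ∑_{μ = λ + □} c(□)^k s_μ` on all Schur functions. -/
def IsUFamily (K : Type*) [Field K] (U : ℕ → Module.End K (SymFun K)) : Prop :=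
  ∀ (k : ℕ) (lam : YoungDiagram),
    U k (schur K lam) =
      ∑ b ∈ (addable lam).attach, ((content b.1 : K) ^ k) • schur K (addCell lam b.1 b.2)

/-! ### Differential operators in the power sums -/

/-- The operator `p_i^⊥ = i ∂/∂p_i`. -/
noncomputable def pPerp (K : Type*) [Field K] (i : ℕ+) : Module.End K (SymFun K) :=
  ((i : ℕ) : K) • (pderiv i : Derivation K (SymFun K) (SymFun K)).toLinearMap

theorem pPerp_monomial (K : Type*) [Field K] (i : ℕ+) (β : Part) (r : K) :
    pPerp K i (monomial β r) =
      monomial (β - Finsupp.single i 1) (r * ((i : ℕ) : K) * (β i : K)) := by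
  change ((i : ℕ) : K) • pderiv i (monomial β r) = _
  rw [pderiv_monomial, smul_monomial, smul_eq_mul]
  congr 1
  ring

theorem end_ext {K : Type*} [Field K] {A B : Module.End K (SymFun K)}
    (h : ∀ α r, A (monomial α r) = B (monomial α r)) : A = B := by
  refine LinearMap.ext fun f => ?_
  induction f using MvPolynomial.induction_on' with
  | monomial α r => exact h α r
  | add p q hp hq => rw [map_add, map_add, hp, hq]

theorem pPerp_commute (K : Type*) [Field K] (i j : ℕ+) : Commute (pPerp K i) (pPerp K j) := by
  rcases eq_or_ne i j with rfl | hij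
  · exact Commute.refl _
  · refine end_ext fun β r => ?_
    simp only [Module.End.mul_apply, pPerp_monomial]
    have e : β - Finsupp.single j 1 - Finsupp.single i 1 =
        β - Finsupp.single i 1 - Finsupp.single j 1 := tsub_right_comm
    rw [e]
    congr 1
    simp [hij, hij.symm]
    ring

theorem pPerp_pow_monomial (K : Type*) [Field K] (i : ℕ+) (n : ℕ) (β : Part) (r : K) :
    (pPerp K i ^ n) (monomial β r) =
      monomial (β - Finsupp.single i n)
        (r * (((i : ℕ) : K) ^ n * ((β i).descFactorial n : K))) := by
  induction n with
  | zero => simp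
  | succ n ih =>
    rw [pow_succ', Module.End.mul_apply, ih, pPerp_monomial]
    have e : β - Finsupp.single i n - Finsupp.single i 1 = β - Finsupp.single i (n + 1) := by
      rw [tsub_tsub, ← Finsupp.single_add]
    rw [e]
    congr 1
    simp [Nat.descFactorial_succ]
    ring

theorem pPerp_pairwise (K : Type*) [Field K] (α : Part) (s : Finset ℕ+) :
    (s : Set ℕ+).Pairwise (Function.onFun Commute fun i => pPerp K i ^ α i) :=
  fun i _ j _ _ => (pPerp_commute K i j).pow_pow (α i) (α j)

/-- The operator `p_α^⊥ = ∏_i (p_i^⊥)^{m_i}` for the partition `α = 1^{m₁} 2^{m₂} ⋯`. -/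
noncomputable def pPerpPart (K : Type*) [Field K] (α : Part) : Module.End K (SymFun K) :=
  α.support.noncommProd (fun i => pPerp K i ^ α i) (pPerp_pairwise K α α.support)

theorem pPerp_noncommProd_monomial (K : Type*) [Field K] (α : Part) (s : Finset ℕ+)
    (β : Part) (r : K) :
    (s.noncommProd (fun i => pPerp K i ^ α i) (pPerp_pairwise K α s)) (monomial β r) =
      monomial (β - α.filter (· ∈ s))
        (r * ∏ i ∈ s, (((i : ℕ) : K) ^ α i * ((β i).descFactorial (α i) : K))) := by
  induction s using Finset.induction_on with
  | empty =>
    have e : α.filter (· ∈ (∅ : Finset ℕ+)) = 0 := by ext; simp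
    rw [e, Finset.noncommProd_empty]; simp
  | insert a s ha ih =>
    rw [Finset.noncommProd_insert_of_notMem _ _ _ _ ha, Module.End.mul_apply, ih,
      pPerp_pow_monomial]
    have e : β - α.filter (· ∈ s) - Finsupp.single a (α a) = β - α.filter (· ∈ insert a s) := by
      ext i
      simp only [Finsupp.coe_tsub, Pi.sub_apply, Finsupp.filter_apply, Finset.mem_insert]
      rcases eq_or_ne i a with rfl | hi
      · simp [ha]
      · simp [hi]
    rw [e, Finset.prod_insert ha]
    congr 1
    simp [ha]
    ring

theorem pPerpPart_monomial (K : Type*) [Field K] (α β : Part) (r : K) :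
    pPerpPart K α (monomial β r) =
      monomial (β - α)
        (r * ∏ i ∈ α.support, (((i : ℕ) : K) ^ α i * ((β i).descFactorial (α i) : K))) := by
  have e : α.filter (· ∈ α.support) = α := by
    ext i; by_cases h : i ∈ α.support <;> simp_all
  have := pPerp_noncommProd_monomial K α α.support β r
  rw [e] at this
  exact this

theorem pPerpPart_monomial_eq_zero (K : Type*) [Field K] {α β : Part} (h : ¬ α ≤ β) (r : K) :
    pPerpPart K α (monomial β r) = 0 := by
  rw [pPerpPart_monomial]
  rw [Finsupp.le_def] at h
  push Not at h
  obtain ⟨i, hi⟩ := h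
  have : ∏ i ∈ α.support, (((i : ℕ) : K) ^ α i * ((β i).descFactorial (α i) : K)) = 0 := by
    refine Finset.prod_eq_zero (i := i) (Finsupp.mem_support_iff.mpr (by omega)) ?_
    rw [Nat.descFactorial_eq_zero_iff_lt.mpr hi]
    simp
  rw [this]; simp

/-- The nonzero scalar `p_α^⊥ p_α`. -/
noncomputable def zPart (K : Type*) [Field K] (α : Part) : K :=
  ∏ i ∈ α.support, (((i : ℕ) : K) ^ α i * ((α i).factorial : K))

theorem zPart_ne_zero (K : Type*) [Field K] [CharZero K] (α : Part) : zPart K α ≠ 0 := by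
  refine Finset.prod_ne_zero_iff.mpr fun i _ => mul_ne_zero (pow_ne_zero _ ?_) ?_
  · exact_mod_cast i.ne_zero
  · exact_mod_cast (α i).factorial_ne_zero

theorem pPerpPart_self (K : Type*) [Field K] (α : Part) :
    pPerpPart K α (monomial α 1) = C (zPart K α) := by
  rw [pPerpPart_monomial]
  simp [zPart, Nat.descFactorial_self]

theorem pPerpPart_finite (K : Type*) [Field K] (f : SymFun K) :
    {α : Part | pPerpPart K α f ≠ 0}.Finite := by
  classical
  refine Set.Finite.subset (f.support.finite_toSet.biUnion fun β _ => Set.finite_Iic β) ?_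
  intro α hα
  by_contra hne
  refine hα ?_
  simp only [Set.mem_iUnion, not_exists, Set.mem_Iic] at hne
  rw [f.as_sum, map_sum]
  exact Finset.sum_eq_zero fun β hβ => pPerpPart_monomial_eq_zero K (hne β hβ) _

theorem normal_finite (K : Type*) [Field K] (c : Part → SymFun K) (f : SymFun K) :
    (Function.support fun α => c α * pPerpPart K α f).Finite := by
  refine (pPerpPart_finite K f).subset fun α hα h => hα ?_
  simp only
  rw [h, mul_zero]

/-- The differential operator `∑_α c_α p_α^⊥` with coefficients `c_α ∈ K[p₁, p₂, …]`, where the sum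
is over all partitions. Only finitely many terms are nonzero on a given `f`. -/
noncomputable def normalOp (K : Type*) [Field K] (c : Part → SymFun K) : Module.End K (SymFun K) where
  toFun f := ∑ᶠ α, c α * pPerpPart K α f
  map_add' f g := by
    rw [← finsum_add_distrib (normal_finite K c f) (normal_finite K c g)]
    simp [mul_add]
  map_smul' r f := by
    rw [RingHom.id_apply, smul_finsum' r (normal_finite K c f)]
    simp

theorem normalOp_apply (K : Type*) [Field K] (c : Part → SymFun K) (f : SymFun K) :
    normalOp K c f = ∑ᶠ α, c α * pPerpPart K α f := rfl

theorem normalOp_monomial (K : Type*) [Field K] (c : Part → SymFun K) (α : Part) :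
    normalOp K c (monomial α 1) =
      C (zPart K α) * c α + ∑ β ∈ Finset.Iio α, c β * pPerpPart K β (monomial α 1) := by
  classical
  rw [normalOp_apply, finsum_eq_sum_of_support_subset (s := Finset.Iic α)]
  · rw [← Finset.Iio_insert, Finset.sum_insert (by simp), pPerpPart_self, mul_comm]
  · intro β hβ
    by_contra hne
    refine hβ ?_
    simp only
    rw [pPerpPart_monomial_eq_zero K (by simpa using hne), mul_zero]

/-- Every linear operator on `K[p₁, p₂, …]` has a unique expansion `∑_α c_α p_α^⊥`. -/
theorem existsUnique_normalOp (K : Type*) [Field K] [CharZero K] (A : Module.End K (SymFun K)) :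
    ∃! c : Part → SymFun K, normalOp K c = A := by
  classical
  have wf : WellFounded (fun α β : Part => α < β) := wellFounded_lt
  have step : ∀ (α : Part) (x y : SymFun K),
      C (zPart K α) * x = y ↔ x = C (zPart K α)⁻¹ * y := by
    intro α x y
    have h1 : C (zPart K α)⁻¹ * C (zPart K α) = (1 : SymFun K) := by
      rw [← C_mul, inv_mul_cancel₀ (zPart_ne_zero K α), C_1]
    constructor
    · rintro rfl
      rw [← mul_assoc, h1, one_mul]
    · rintro rfl
      rw [← mul_assoc, mul_comm (C (zPart K α)), h1, one_mul]
  have iff : ∀ c : Part → SymFun K, normalOp K c = A ↔ ∀ α, c α = C (zPart K α)⁻¹ *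
      (A (monomial α 1) - ∑ β ∈ Finset.Iio α, c β * pPerpPart K β (monomial α 1)) := by
    intro c
    constructor
    · rintro rfl α
      rw [← step, normalOp_monomial, add_sub_cancel_right]
    · intro h
      refine end_ext fun α r => ?_
      have e : (monomial α r : SymFun K) = r • monomial α 1 := by
        rw [smul_monomial, smul_eq_mul, mul_one]
      have := (step α _ _).mpr (h α)
      rw [e, map_smul, map_smul, normalOp_monomial, this, sub_add_cancel]
  let c : Part → SymFun K := wf.fix fun α ih => C (zPart K α)⁻¹ *
    (A (monomial α 1) -
      ∑ β ∈ (Finset.Iio α).attach,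
        ih β.1 (Finset.mem_Iio.mp β.2) * pPerpPart K β.1 (monomial α 1))
  refine ⟨c, (iff c).mpr fun α => ?_, fun d hd => ?_⟩
  · rw [← Finset.sum_attach]
    exact wf.fix_eq _ α
  · funext α
    induction α using wf.induction with
    | _ α ih =>
      rw [(iff d).mp hd α, show c α = _ from wf.fix_eq _ α]
      congr 2
      rw [← Finset.sum_attach]
      exact Finset.sum_congr rfl fun β _ => by rw [ih β.1 (Finset.mem_Iio.mp β.2)]

/-- The coefficients `c_α` in the unique expansion `A = ∑_α c_α p_α^⊥` of an operator `A`. -/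
noncomputable def normalCoeff (K : Type*) [Field K] [CharZero K] (A : Module.End K (SymFun K)) :
    Part → SymFun K :=
  (existsUnique_normalOp K A).choose

theorem normalOp_normalCoeff (K : Type*) [Field K] [CharZero K] (A : Module.End K (SymFun K)) :
    normalOp K (normalCoeff K A) = A :=
  (existsUnique_normalOp K A).choose_spec.1

theorem normalCoeff_normalOp (K : Type*) [Field K] [CharZero K] (c : Part → SymFun K) :
    normalCoeff K (normalOp K c) = c :=
  ((existsUnique_normalOp K (normalOp K c)).choose_spec.2 c rfl).symm

/-- The part of total degree `d` of an operator `A = ∑ c(γ, α) p_γ p_α^⊥`, that is, the sum of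
its terms `c(γ, α) p_γ p_α^⊥` with `l(γ) + l(α) = d`. -/
noncomputable def degreePart (K : Type*) [Field K] [CharZero K] (d : ℕ)
    (A : Module.End K (SymFun K)) : Module.End K (SymFun K) :=
  normalOp K fun α =>
    if α.degree ≤ d then homogeneousComponent (d - α.degree) (normalCoeff K A α) else 0

/-- For an operator `A` of index `k`, the part `A^{(h)}`, consisting of the terms of total degree
`k + 1 - 2h` (there are none if `2h > k + 1`). -/
noncomputable def genusPart (K : Type*) [Field K] [CharZero K] (k h : ℕ)
    (A : Module.End K (SymFun K)) : Module.End K (SymFun K) :=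
  if 2 * h ≤ k + 1 then degreePart K (k + 1 - 2 * h) A else 0

/-! ### The sum over `a₁ + ⋯ + a_j = b₁ + ⋯ + b_m + 1` -/

/-- All positive integers `a₁, …, a_j, b₁, …, b_m` with `a₁ + ⋯ + a_j = b₁ + ⋯ + b_m + 1`. -/
def balanced (j m : ℕ) : Set ((Fin j → ℕ+) × (Fin m → ℕ+)) :=
  {t | ∑ i, (t.1 i : ℕ) = ∑ i, (t.2 i : ℕ) + 1}

/-- The operator `p_{a₁} ⋯ p_{a_j} p_{b₁}^⊥ ⋯ p_{b_m}^⊥`. -/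
noncomputable def term (K : Type*) [Field K] {j m : ℕ}
    (t : (Fin j → ℕ+) × (Fin m → ℕ+)) : Module.End K (SymFun K) :=
  LinearMap.mulLeft K (∏ i, (X (t.1 i) : SymFun K)) * (List.ofFn fun i => pPerp K (t.2 i)).prod

theorem pPerp_list_eq_zero (K : Type*) [Field K] (f : SymFun K) (L : List ℕ+) (b : ℕ+)
    (hb : b ∈ L) (hf : b ∉ f.vars) : ((L.map (pPerp K)).prod) f = 0 := by
  have hcomm : Commute (pPerp K b) ((L.map (pPerp K)).prod) :=
    Commute.list_prod_right _ _ fun y hy => by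
      obtain ⟨i, -, rfl⟩ := List.mem_map.mp hy
      exact pPerp_commute K b i
  have h0 : pPerp K b f = 0 := by
    simp [pPerp, pderiv_eq_zero_of_notMem_vars hf]
  induction L with
  | nil => simp at hb
  | cons a L ih =>
    rw [List.map_cons, List.prod_cons, Module.End.mul_apply]
    have hcL : Commute (pPerp K b) ((L.map (pPerp K)).prod) :=
      Commute.list_prod_right _ _ fun y hy => by
        obtain ⟨i, -, rfl⟩ := List.mem_map.mp hy
        exact pPerp_commute K b i
    rcases List.mem_cons.mp hb with rfl | hb
    · rw [← Module.End.mul_apply, hcL.eq, Module.End.mul_apply, h0, map_zero]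
    · rw [ih hb hcL, map_zero]

theorem term_finite (K : Type*) [Field K] (j m : ℕ) (f : SymFun K) :
    (Function.support fun t : balanced j m => term K t.1 f).Finite := by
  classical
  set N : ℕ := ∑ i : Fin m, (f.vars.sup fun v => (v : ℕ)) + 1 with hN
  have hfin : {t : (Fin j → ℕ+) × (Fin m → ℕ+) |
      (∀ i, t.1 i ∈ {x : ℕ+ | (x : ℕ) ≤ N}) ∧ ∀ i, t.2 i ∈ (f.vars : Set ℕ+)}.Finite := by
    have h1 : {x : ℕ+ | (x : ℕ) ≤ N}.Finite :=
      (Set.finite_Iic N).preimage (fun a _ b _ h => PNat.coe_injective h)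
    refine Set.Finite.subset ((Set.Finite.pi' (ι := Fin j) fun _ => h1).prod
      (Set.Finite.pi' (ι := Fin m) fun _ => f.vars.finite_toSet)) ?_
    rintro ⟨a, b⟩ ⟨ha, hb⟩
    exact ⟨ha, hb⟩
  refine (hfin.preimage Subtype.val_injective.injOn).subset ?_
  rintro ⟨⟨a, b⟩, hab⟩ ht
  have hb : ∀ i, b i ∈ f.vars := by
    intro i
    by_contra hi
    refine ht ?_
    have h := pPerp_list_eq_zero K f (List.ofFn b) (b i) (by simp [List.mem_ofFn]) hi
    rw [List.map_ofFn] at h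
    change ((List.ofFn fun i => pPerp K (b i)).prod) f = 0 at h
    simp only [term, Module.End.mul_apply]
    rw [h, map_zero]
  refine ⟨fun i => ?_, hb⟩
  have h1 : (a i : ℕ) ≤ ∑ i, (a i : ℕ) :=
    Finset.single_le_sum (f := fun i => (a i : ℕ)) (fun _ _ => Nat.zero_le _) (Finset.mem_univ i)
  have h2 : ∑ i, (a i : ℕ) = ∑ i, (b i : ℕ) + 1 := hab
  have h3 : ∑ i, (b i : ℕ) ≤ ∑ i : Fin m, (f.vars.sup fun v => (v : ℕ)) :=
    Finset.sum_le_sum fun i _ => Finset.le_sup (f := fun v : ℕ+ => (v : ℕ)) (hb i)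
  change (a i : ℕ) ≤ N
  omega

/-- The operator `∑ p_{a₁} ⋯ p_{a_j} p_{b₁}^⊥ ⋯ p_{b_m}^⊥`, summed over all positive integers with
`a₁ + ⋯ + a_j = b₁ + ⋯ + b_m + 1`. Only finitely many terms are nonzero on a given `f`. -/
noncomputable def balancedSum (K : Type*) [Field K] (j m : ℕ) : Module.End K (SymFun K) where
  toFun f := ∑ᶠ t : balanced j m, term K t.1 f
  map_add' f g := by
    rw [← finsum_add_distrib (term_finite K j m f) (term_finite K j m g)]
    simp
  map_smul' r f := by
    rw [RingHom.id_apply, smul_finsum' r (term_finite K j m f)]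
    simp

end ContentOps

namespace ContentOps

open MvPolynomial

/-! Each Schur function is an eigenvector of `cutJoin`, with eigenvalue the sum of the contents of
its diagram, and p_1 s_λ is the sum of all s_μ with μ = λ + □. A commutator with `cutJoin` therefore
multiplies the term of μ by c(□), so U_k is the k-fold commutator `contentOp`
(`isUFamily_contentOp`). It is the only choice because the Schur functions span (`span_schur`).

The eigenvalue comes from Bernstein operators: a Jacobi–Trudi determinant is a product of them
applied to 1 (`jacobiTrudi_succ`), and moving `cutJoin` past one of them costs an explicit scalar
and an Euler operator (`cutJoin_mul_bernstein`). Such relations are proved by `eq_zero_of_mode_lie`,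
which reduces them to commutators with p_i, p_i^⊥ and to constant terms.

For the top degree, let φ(z) = ∑ (p_i z^i + p_i^⊥ z^{-i}) and let B_{r,k} (`leading`) be the
coefficient of z^r in the normally ordered φ^{k+1}/(k+1). Operators are filtered by how many
commutators with the modes of φ kill them (`lieFilt`), which bounds the total degree in the p_i and
p_i^⊥. The total degree of a commutator is at most the sum of the two degrees minus two
(`comm_mem_lieFilt`), and up to lower order [B_{s,j}, B_{r,k}] is (jr - ks) B_{r+s,j+k-1}
(`comm_family_mem_lieFilt`). Since `cutJoin` is B_{0,2}/2, its bracket with B_{1,k} is B_{1,k+1} to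
top order. By induction U_k agrees with B_{1,k} up to total degree at most k
(`contentOp_sub_leading_mem`), so U_k^{(0)} = B_{1,k}. The binomial theorem expands B_{1,k} into the
stated sum; for k ≥ 1 the extreme terms j = 0 and j = k + 1 are empty (`leading_one_eq_sum`). -/

/-! ### Commutation rules for p_i, p_i^⊥ and normally ordered operators. -/

theorem pPerp_apply (K : Type*) [Field K] (i : ℕ+) (f : SymFun K) :
    pPerp K i f = ((i : ℕ) : K) • pderiv i f := rfl

theorem pPerp_mul (K : Type*) [Field K] (i : ℕ+) (f g : SymFun K) :
    pPerp K i (f * g) = pPerp K i f * g + f * pPerp K i g := by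
  simp only [pPerp_apply, Derivation.leibniz, smul_eq_mul, smul_add, mul_smul_comm,
    smul_mul_assoc]
  rw [add_comm, mul_comm g]

theorem pPerp_C (K : Type*) [Field K] (i : ℕ+) (r : K) : pPerp K i (C r) = 0 := by
  simp [pPerp]

theorem pPerp_one (K : Type*) [Field K] (i : ℕ+) : pPerp K i 1 = 0 := by
  simp [pPerp]

theorem pPerp_X (K : Type*) [Field K] (i j : ℕ+) :
    pPerp K i (X j) = if i = j then C ((i : ℕ) : K) else 0 := by
  split_ifs with h
  · subst h
    simp [pPerp, smul_eq_C_mul]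
  · simp [pPerp, pderiv_X_of_ne (Ne.symm h)]

theorem coeff_pPerp (K : Type*) [Field K] (i : ℕ+) (f : SymFun K) (α : Part) :
    coeff α (pPerp K i f) =
      ((i : ℕ) : K) * ((α i + 1 : ℕ) : K) * coeff (α + Finsupp.single i 1) f := by
  induction f using MvPolynomial.induction_on' with
  | monomial β r =>
    rw [pPerp_monomial, coeff_monomial, coeff_monomial]
    by_cases h : β = α + Finsupp.single i 1
    · subst h
      simp
      ring
    · rw [if_neg h, mul_zero]
      split_ifs with h'
      · have hb : β i = 0 := by
          by_contra hb
          apply h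
          rw [← h', tsub_add_cancel_of_le]
          rw [Finsupp.single_le_iff]
          omega
        simp [hb]
      · rfl
  | add p q hp hq => rw [map_add, coeff_add, coeff_add, hp, hq, mul_add]

theorem pPerp_homogeneousComponent (K : Type*) [Field K] (i : ℕ+) (n : ℕ) (f : SymFun K) :
    pPerp K i (homogeneousComponent (n + 1) f) = homogeneousComponent n (pPerp K i f) := by
  ext α
  rw [coeff_pPerp, coeff_homogeneousComponent, coeff_homogeneousComponent, coeff_pPerp]
  have : (α + Finsupp.single i 1).degree = α.degree + 1 := by simp
  simp only [this, add_left_inj]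
  split_ifs <;> simp

/-- A symmetric function killed by all `p_i^⊥` is a constant. -/
theorem eq_C_of_pPerp_eq_zero (K : Type*) [Field K] [CharZero K] (f : SymFun K)
    (h : ∀ i, pPerp K i f = 0) : f = C (constantCoeff f) := by
  classical
  ext α
  rw [coeff_C]
  split_ifs with h0
  · rw [← h0]; rfl
  · obtain ⟨i, hi⟩ : ∃ i, α i ≠ 0 := by
      by_contra hne
      push Not at hne
      exact h0 (Finsupp.ext fun i => (hne i).symm)
    have e : α - Finsupp.single i 1 + Finsupp.single i 1 = α :=
      tsub_add_cancel_of_le (by rw [Finsupp.single_le_iff]; omega)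
    have := coeff_pPerp K i f (α - Finsupp.single i 1)
    rw [h i, coeff_zero, e] at this
    have h1 : ((i : ℕ) : K) ≠ 0 := by exact_mod_cast i.ne_zero
    rcases mul_eq_zero.mp this.symm with h2 | h2
    · rcases mul_eq_zero.mp h2 with h3 | h3
      · exact absurd h3 h1
      · exact absurd h3 (Nat.cast_ne_zero.mpr (Nat.succ_ne_zero _))
    · exact h2

theorem exists_eq_add_single {α : Part} (h : α ≠ 0) :
    ∃ (β : Part) (i : ℕ+), α = β + Finsupp.single i 1 := by
  obtain ⟨i, hi⟩ : ∃ i, α i ≠ 0 := by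
    by_contra hne
    push Not at hne
    exact h (Finsupp.ext hne)
  exact ⟨α - Finsupp.single i 1, i,
    (tsub_add_cancel_of_le (by rw [Finsupp.single_le_iff]; omega)).symm⟩

theorem part_induction {motive : Part → Prop} (zero : motive 0)
    (add : ∀ α i, motive α → motive (α + Finsupp.single i 1)) (α : Part) : motive α := by
  induction h : α.degree generalizing α with
  | zero => rwa [(Finsupp.degree_eq_zero_iff α).mp h]
  | succ n ih =>
    have h0 : α ≠ 0 := by rintro rfl; simp at h
    obtain ⟨β, i, rfl⟩ := exists_eq_add_single h0
    exact add β i (ih β (by simpa using h))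

theorem pPerpPart_zero (K : Type*) [Field K] : pPerpPart K 0 = 1 := by
  refine end_ext fun β r => ?_
  simp [pPerpPart_monomial]

/-- This recursion, with `part_induction`, replaces the noncommutative product in the definition in
later arguments. -/
theorem pPerpPart_add_single (K : Type*) [Field K] (α : Part) (i : ℕ+) :
    pPerpPart K (α + Finsupp.single i 1) = pPerpPart K α * pPerp K i := by
  classical
  refine end_ext fun β r => ?_
  rw [Module.End.mul_apply, pPerp_monomial, pPerpPart_monomial, pPerpPart_monomial]
  have e : β - (α + Finsupp.single i 1) = β - Finsupp.single i 1 - α := by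
    rw [add_comm, tsub_tsub]
  rw [e]
  congr 1
  -- Both products are extended to the common index set `s`; the added factors are 1.
  set s := insert i α.support with hs
  have h1 : (α + Finsupp.single i 1).support ⊆ s := by
    refine Finsupp.support_add.trans ?_
    refine Finset.union_subset (Finset.subset_insert _ _) ?_
    exact Finsupp.support_single_subset.trans (by simp [hs])
  rw [Finset.prod_subset h1 (by intro x _ hx; rw [Finsupp.notMem_support_iff] at hx; simp [hx]),
    Finset.prod_subset (Finset.subset_insert i α.support)
      (by intro x _ hx; rw [Finsupp.notMem_support_iff] at hx; simp [hx]),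
    ← Finset.mul_prod_erase s _ (Finset.mem_insert_self i _),
    ← Finset.mul_prod_erase s _ (Finset.mem_insert_self i _)]
  have h2 : ∀ x ∈ s.erase i, (((x : ℕ) : K) ^ ((α + Finsupp.single i 1 : Part) x) *
      ((β x).descFactorial ((α + Finsupp.single i 1 : Part) x) : K)) =
      (((x : ℕ) : K) ^ α x * (((β - Finsupp.single i 1 : Part) x).descFactorial (α x) : K)) := by
    intro x hx
    have hne : i ≠ x := (Finset.ne_of_mem_erase hx).symm
    simp [hne]
  rw [Finset.prod_congr rfl h2]
  have h3 : ((β i).descFactorial (α i + 1) : K) =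
      (β i : K) * ((β i - 1).descFactorial (α i) : K) := by
    cases h : β i with
    | zero => simp
    | succ n => rw [Nat.succ_descFactorial_succ, Nat.cast_mul, Nat.add_sub_cancel]
  simp only [Finsupp.add_apply, Finsupp.single_eq_same, h3, Finsupp.coe_tsub, Pi.sub_apply]
  ring

theorem pPerpPart_single (K : Type*) [Field K] (i : ℕ+) :
    pPerpPart K (Finsupp.single i 1) = pPerp K i := by
  simpa [pPerpPart_zero] using pPerpPart_add_single K 0 i

theorem pPerpPart_commute (K : Type*) [Field K] (α : Part) (i : ℕ+) :
    Commute (pPerpPart K α) (pPerp K i) := by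
  induction α using part_induction with
  | zero => rw [pPerpPart_zero]; exact Commute.one_left _
  | add α j ih => rw [pPerpPart_add_single]; exact ih.mul_left (pPerp_commute K j i)

/-- Iterated Leibniz rule: exactly one of the α_i factors p_i^⊥ may hit the variable p_i. If α_i = 0
the truncated subtraction is harmless, since its coefficient vanishes. -/
theorem pPerpPart_X_mul (K : Type*) [Field K] (α : Part) (i : ℕ+) (f : SymFun K) :
    pPerpPart K α (X i * f) = X i * pPerpPart K α f +
      (((i : ℕ) : K) * (α i : K)) • pPerpPart K (α - Finsupp.single i 1) f := by
  induction α using part_induction generalizing f with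
  | zero => simp [pPerpPart_zero]
  | add α j ih =>
    rw [pPerpPart_add_single, Module.End.mul_apply, Module.End.mul_apply, pPerp_mul, pPerp_X,
      map_add, ih, ← Module.End.mul_apply (pPerpPart K (α - Finsupp.single i 1)),
      ← pPerpPart_add_single]
    rcases eq_or_ne j i with rfl | hji
    · rw [if_pos rfl, ← smul_eq_C_mul, map_smul, add_tsub_cancel_right]
      rcases Nat.eq_zero_or_pos (α j) with h0 | h0
      · simp [h0, add_comm]
      · rw [tsub_add_cancel_of_le (by rw [Finsupp.single_le_iff]; omega)]
        simp only [Finsupp.add_apply, Finsupp.single_eq_same, Nat.cast_add, Nat.cast_one, mul_add,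
          mul_one, add_smul]
        abel
    · rw [if_neg hji, zero_mul, map_zero, zero_add]
      rcases Nat.eq_zero_or_pos (α i) with h0 | h0
      · simp [h0, hji.symm]
      · rw [tsub_add_eq_add_tsub (by rw [Finsupp.single_le_iff]; omega)]
        simp [hji.symm]

/-- In normal order p_i^⊥ commutes with every p_α^⊥, so only its action on the coefficients is left.
-/
theorem pPerp_normalOp (K : Type*) [Field K] (c : Part → SymFun K) (i : ℕ+) :
    ⁅pPerp K i, normalOp K c⁆ = normalOp K fun α => pPerp K i (c α) := by
  refine LinearMap.ext fun f => ?_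
  rw [Ring.lie_def, LinearMap.sub_apply, Module.End.mul_apply, Module.End.mul_apply,
    sub_eq_iff_eq_add, normalOp_apply, normalOp_apply, normalOp_apply,
    map_finsum _ (normal_finite K c f),
    ← finsum_add_distrib (normal_finite K _ _) (normal_finite K _ _)]
  refine finsum_congr fun α => ?_
  rw [pPerp_mul, ← Module.End.mul_apply (pPerp K i), ← (pPerpPart_commute K α i).eq,
    Module.End.mul_apply]

theorem normalOp_X (K : Type*) [Field K] (c : Part → SymFun K) (i : ℕ+) :
    ⁅normalOp K c, LinearMap.mulLeft K (X i : SymFun K)⁆ = normalOp K fun α =>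
      (((i : ℕ) : K) * ((α i + 1 : ℕ) : K)) • c (α + Finsupp.single i 1) := by
  refine LinearMap.ext fun f => ?_
  have hX := smul_finsum' (X i : SymFun K) (normal_finite K c f)
  simp only [smul_eq_mul] at hX
  rw [Ring.lie_def, LinearMap.sub_apply, Module.End.mul_apply, Module.End.mul_apply,
    LinearMap.mulLeft_apply, LinearMap.mulLeft_apply,
    sub_eq_iff_eq_add', normalOp_apply, normalOp_apply, normalOp_apply, hX]
  set g : Part → SymFun K := fun α => c α *
    ((((i : ℕ) : K) * (α i : K)) • pPerpPart K (α - Finsupp.single i 1) f) with hg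
  have inj : Function.Injective fun α : Part => α + Finsupp.single i 1 :=
    add_left_injective _
  have key : ∑ᶠ α, g α = ∑ᶠ α, ((((i : ℕ) : K) * ((α i + 1 : ℕ) : K)) •
      c (α + Finsupp.single i 1)) * pPerpPart K α f := by
    -- The factor α_i kills every term without a part i, so the sum may be reindexed by removing one
    -- such part.
    have h1 : ∑ᶠ α ∈ Set.range fun α : Part => α + Finsupp.single i 1, g α = ∑ᶠ α, g α := by
      rw [← finsum_mem_univ g]
      refine finsum_mem_inter_support_eq _ _ _ ?_
      ext α
      simp only [Set.mem_inter_iff, Set.mem_range, Function.mem_support, Set.mem_univ, true_and,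
        and_iff_right_iff_imp]
      intro hα
      have : α i ≠ 0 := fun h0 => hα (by simp [hg, h0])
      exact ⟨α - Finsupp.single i 1,
        tsub_add_cancel_of_le (by rw [Finsupp.single_le_iff]; omega)⟩
    rw [← h1, finsum_mem_range inj]
    refine finsum_congr fun α => ?_
    simp [hg]
  have fin2 := normal_finite K (fun α => (((i : ℕ) : K) * ((α i + 1 : ℕ) : K)) •
      c (α + Finsupp.single i 1)) f
  have fing : (Function.support g).Finite := by
    refine (fin2.image fun α => α + Finsupp.single i 1).subset ?_
    intro α hα
    have : α i ≠ 0 := fun h0 => hα (by simp [hg, h0])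
    have e : α - Finsupp.single i 1 + Finsupp.single i 1 = α :=
      tsub_add_cancel_of_le (by rw [Finsupp.single_le_iff]; omega)
    refine ⟨α - Finsupp.single i 1, ?_, e⟩
    rw [← e] at hα
    simpa [hg] using hα
  rw [← key, ← finsum_add_distrib ?_ fing]
  · refine finsum_congr fun α => ?_
    rw [pPerpPart_X_mul, mul_add]
    ring
  · exact (normal_finite K c f).subset fun α hα h => hα (by simp only [h, mul_zero])

theorem normalCoeff_lie_pPerp (K : Type*) [Field K] [CharZero K] (A : Module.End K (SymFun K))
    (i : ℕ+) (α : Part) : normalCoeff K ⁅pPerp K i, A⁆ α = pPerp K i (normalCoeff K A α) := by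
  conv_lhs => rw [← normalOp_normalCoeff K A, pPerp_normalOp, normalCoeff_normalOp]

theorem normalCoeff_lie_X (K : Type*) [Field K] [CharZero K] (A : Module.End K (SymFun K))
    (i : ℕ+) (α : Part) : normalCoeff K ⁅A, LinearMap.mulLeft K (X i : SymFun K)⁆ α =
      (((i : ℕ) : K) * ((α i + 1 : ℕ) : K)) • normalCoeff K A (α + Finsupp.single i 1) := by
  conv_lhs => rw [← normalOp_normalCoeff K A, normalOp_X, normalCoeff_normalOp]

/-! ### Powers of the generating function of the power sums -/

/-- The generating function `∑_{i ≥ 1} p_i z^i`. -/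
noncomputable def psumSeries (K : Type*) [Field K] : PowerSeries (SymFun K) :=
  PowerSeries.mk fun n => if h : 0 < n then X (n.toPNat h) else 0

/-- The coefficient of `z^n` in `(∑_{i ≥ 1} p_i z^i)^j`. -/
noncomputable def psumPow (K : Type*) [Field K] (j : ℕ) (n : ℤ) : SymFun K :=
  if 0 ≤ n then PowerSeries.coeff n.toNat (psumSeries K ^ j) else 0

/-- The coefficientwise action of `p_i^⊥` on power series. -/
noncomputable def pPerpSeries (K : Type*) [Field K] (i : ℕ+) (A : PowerSeries (SymFun K)) :
    PowerSeries (SymFun K) :=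
  PowerSeries.mk fun n => pPerp K i (PowerSeries.coeff n A)

theorem pPerpSeries_mul (K : Type*) [Field K] (i : ℕ+) (A B : PowerSeries (SymFun K)) :
    pPerpSeries K i (A * B) = pPerpSeries K i A * B + A * pPerpSeries K i B := by
  ext1 n
  simp only [pPerpSeries, PowerSeries.coeff_mk, PowerSeries.coeff_mul, map_add, map_sum, pPerp_mul,
    Finset.sum_add_distrib]

theorem pPerpSeries_psumSeries (K : Type*) [Field K] (i : ℕ+) :
    pPerpSeries K i (psumSeries K) = ((i : ℕ) : PowerSeries (SymFun K)) * PowerSeries.X ^ (i : ℕ) := by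
  ext1 n
  rw [← nsmul_eq_mul, map_nsmul, PowerSeries.coeff_X_pow, pPerpSeries, psumSeries,
    PowerSeries.coeff_mk, PowerSeries.coeff_mk]
  by_cases h : 0 < n
  · rw [dif_pos h, pPerp_X]
    by_cases hi : n = i
    · subst hi
      rw [if_pos (show i = (i : ℕ).toPNat h from PNat.coe_injective rfl), if_pos rfl, nsmul_one, map_natCast]
    · rw [if_neg hi, if_neg (fun h' => hi (by rw [h']; rfl)), nsmul_zero]
  · rw [dif_neg h, map_zero, if_neg (fun h' : n = i => h (h' ▸ i.pos)), nsmul_zero]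

theorem pPerpSeries_pow (K : Type*) [Field K] (i : ℕ+) (j : ℕ) :
    pPerpSeries K i (psumSeries K ^ j) =
      ((j * i : ℕ) : PowerSeries (SymFun K)) *
        (psumSeries K ^ (j - 1) * PowerSeries.X ^ (i : ℕ)) := by
  induction j with
  | zero =>
    ext1 n
    simp [pPerpSeries, PowerSeries.coeff_one, apply_ite (pPerp K i), pPerp_one]
  | succ j ih =>
    rw [pow_succ, pPerpSeries_mul, ih, pPerpSeries_psumSeries]
    cases j with
    | zero => simp
    | succ j =>
      simp only [Nat.add_sub_cancel]
      push_cast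
      ring

/-- Chain rule for the j-th power of P(z) = ∑ p_i z^i, since p_i^⊥ P(z) = i z^i. -/
theorem pPerp_psumPow (K : Type*) [Field K] (i : ℕ+) (j : ℕ) (n : ℤ) :
    pPerp K i (psumPow K j n) = ((j : K) * ((i : ℕ) : K)) • psumPow K (j - 1) (n - (i : ℕ)) := by
  have h := congrArg (PowerSeries.coeff n.toNat) (pPerpSeries_pow K i j)
  rw [← nsmul_eq_mul, map_nsmul, pPerpSeries, PowerSeries.coeff_mk,
    PowerSeries.coeff_mul_X_pow', ← Nat.cast_smul_eq_nsmul K] at h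
  unfold psumPow
  by_cases hn : 0 ≤ n
  · rw [if_pos hn, h]
    push_cast
    congr 1
    by_cases hi : (i : ℕ) ≤ n.toNat
    · rw [if_pos hi, if_pos (by omega)]
      congr 2
      omega
    · rw [if_neg hi, if_neg (by omega)]
  · have : 0 < (i : ℕ) := i.pos
    rw [if_neg hn, if_neg (by omega), map_zero, smul_zero]

theorem psumPow_zero (K : Type*) [Field K] (n : ℤ) :
    psumPow K 0 n = if n = 0 then 1 else 0 := by
  unfold psumPow
  rw [pow_zero]
  rcases lt_trichotomy n 0 with h | rfl | h
  · rw [if_neg (by omega), if_neg (by omega)]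
  · simp
  · rw [if_pos h.le, if_neg (by omega), PowerSeries.coeff_one, if_neg (by omega)]

theorem coeff_psumSeries_mem (K : Type*) [Field K] (n : ℕ) :
    (PowerSeries.coeff n (psumSeries K)).IsHomogeneous 1 := by
  rw [psumSeries, PowerSeries.coeff_mk]
  split_ifs
  · exact isHomogeneous_X _ _
  · exact isHomogeneous_zero _ _ _

theorem psumPow_isHomogeneous (K : Type*) [Field K] (j : ℕ) (n : ℤ) :
    (psumPow K j n).IsHomogeneous j := by
  have key : ∀ n, (PowerSeries.coeff n (psumSeries K ^ j)).IsHomogeneous j := by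
    induction j with
    | zero =>
      intro n
      rw [pow_zero, PowerSeries.coeff_one]
      split_ifs
      · exact isHomogeneous_one _ _
      · exact isHomogeneous_zero _ _ _
    | succ j ih =>
      intro n
      rw [pow_succ, PowerSeries.coeff_mul]
      exact IsHomogeneous.sum _ _ _ fun x _ => (ih x.1).mul (coeff_psumSeries_mem K x.2)
  unfold psumPow
  split_ifs
  · exact key _
  · exact isHomogeneous_zero _ _ _

/-! ### The operators `[z^r] :(∑ p_i z^i + ∑ p_i^⊥ z^{-i})^N:` -/

/-- The size `∑ i m_i` of the partition `1^{m₁} 2^{m₂} ⋯`. -/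
noncomputable def size (α : Part) : ℕ := Finsupp.weight (fun i : ℕ+ => (i : ℕ)) α

theorem size_zero : size 0 = 0 := by simp [size]

theorem size_add_single (α : Part) (i : ℕ+) : size (α + Finsupp.single i 1) = size α + i := by
  simp [size, map_add, Finsupp.weight_single]

/-- The number of distinct arrangements of the parts of `α`. -/
noncomputable def arrangements (K : Type*) [Field K] (α : Part) : K :=
  coeff α (psumPow K α.degree (size α))

theorem arrangements_zero (K : Type*) [Field K] : arrangements K 0 = 1 := by
  simp [arrangements, psumPow_zero, size_zero]

/-- Comparing coefficients in the chain rule for `psumPow` gives this recursion, so no multinomial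
formula is needed. -/
theorem arrangements_add_single (K : Type*) [Field K] [CharZero K] (α : Part) (i : ℕ+) :
    ((α i + 1 : ℕ) : K) * arrangements K (α + Finsupp.single i 1) =
      ((α.degree + 1 : ℕ) : K) * arrangements K α := by
  have hi : ((i : ℕ) : K) ≠ 0 := by exact_mod_cast i.ne_zero
  have h := congrArg (coeff α) (pPerp_psumPow K i (α.degree + 1) (size α + (i : ℕ)))
  rw [coeff_pPerp, coeff_smul, smul_eq_mul, Nat.add_sub_cancel, add_sub_cancel_right] at h
  have h2 : arrangements K (α + Finsupp.single i 1) =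
      coeff (α + Finsupp.single i 1) (psumPow K (α.degree + 1) (size α + (i : ℕ))) := by
    rw [arrangements, size_add_single]
    simp
  rw [h2, arrangements]
  apply mul_left_cancel₀ hi
  linear_combination h

/-- The coefficient of `z^r` in the normally ordered `N`-th power of
`∑ p_i z^i + ∑ p_i^⊥ z^{-i}`. -/
noncomputable def normalPow (K : Type*) [Field K] (r : ℤ) (N : ℕ) : Module.End K (SymFun K) :=
  normalOp K fun α => ((N.choose α.degree : K) * arrangements K α) •
    psumPow K (N - α.degree) (r + size α)

theorem smul_normalOp (K : Type*) [Field K] (a : K) (c : Part → SymFun K) :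
    a • normalOp K c = normalOp K fun α => a • c α := by
  refine LinearMap.ext fun f => ?_
  rw [LinearMap.smul_apply, normalOp_apply, normalOp_apply, smul_finsum' a (normal_finite K c f)]
  simp

/-- Bracketing with p_i^⊥ differentiates φ^N: one factor φ is replaced by i z^i. -/
theorem pPerp_normalPow (K : Type*) [Field K] (i : ℕ+) (r : ℤ) (N : ℕ) :
    ⁅pPerp K i, normalPow K r N⁆ =
      (((i : ℕ) : K) * (N : K)) • normalPow K (r - (i : ℕ)) (N - 1) := by
  rw [normalPow, pPerp_normalOp]
  rw [normalPow, smul_normalOp]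
  congr 1
  funext α
  rw [map_smul, pPerp_psumPow, smul_smul, smul_smul]
  have e : r + (size α : ℤ) - (i : ℕ) = r - (i : ℕ) + size α := by ring
  have e2 : N - α.degree - 1 = N - 1 - α.degree := by omega
  rw [e, e2]
  congr 1
  have : (N.choose α.degree : K) * ((N - α.degree : ℕ) : K) =
      (N : K) * ((N - 1).choose α.degree : K) := by
    cases N with
    | zero => simp
    | succ N => exact_mod_cast congrArg (Nat.cast (R := K)) (by
        rw [Nat.add_sub_cancel, Nat.choose_mul_succ_eq N α.degree |>.symm, mul_comm])
  linear_combination (arrangements K α * ((i : ℕ) : K)) * this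

/-- The counterpart of `pPerp_normalPow`: here the bracket acts on the p^⊥ half of φ and replaces
one factor by i z^{-i}. -/
theorem normalPow_X (K : Type*) [Field K] [CharZero K] (i : ℕ+) (r : ℤ) (N : ℕ) :
    ⁅normalPow K r N, LinearMap.mulLeft K (X i : SymFun K)⁆ =
      (((i : ℕ) : K) * (N : K)) • normalPow K (r + (i : ℕ)) (N - 1) := by
  rw [normalPow, normalOp_X, normalPow, smul_normalOp]
  congr 1
  funext α
  have hd : (α + Finsupp.single i 1 : Part).degree = α.degree + 1 := by simp
  rw [smul_smul, smul_smul, size_add_single, hd]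
  have e : r + ((size α + (i : ℕ) : ℕ) : ℤ) = r + (i : ℕ) + size α := by push_cast; ring
  have e2 : N - (α.degree + 1) = N - 1 - α.degree := by omega
  rw [e, e2]
  congr 1
  have h1 := arrangements_add_single K α i
  have : (N.choose (α.degree + 1) : K) * ((α.degree + 1 : ℕ) : K) =
      (N : K) * ((N - 1).choose α.degree : K) := by
    cases N with
    | zero => simp
    | succ N => exact_mod_cast (Nat.add_one_mul_choose_eq N α.degree).symm
  linear_combination ((i : ℕ) : K) * (N.choose (α.degree + 1) : K) * h1 +
    ((i : ℕ) : K) * arrangements K α * this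

theorem normalPow_zero (K : Type*) [Field K] (r : ℤ) :
    normalPow K r 0 = if r = 0 then 1 else 0 := by
  refine LinearMap.ext fun f => ?_
  rw [normalPow, normalOp_apply, finsum_eq_single _ (0 : Part)]
  · simp only [size_zero, map_zero, Nat.choose_self, arrangements_zero, Nat.sub_zero, psumPow_zero,
      pPerpPart_zero]
    by_cases h : r = 0 <;> simp [h]
  · intro α hα
    have : Nat.choose 0 α.degree = 0 :=
      Nat.choose_eq_zero_of_lt (Nat.pos_of_ne_zero fun h => hα ((Finsupp.degree_eq_zero_iff α).mp h))
    simp [this]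

/-- The operators `p_s` for `s > 0` and `p_{-s}^⊥` for `s < 0`. -/
noncomputable def mode (K : Type*) [Field K] (s : ℤ) : Module.End K (SymFun K) :=
  if h : 0 < s.toNat then LinearMap.mulLeft K (X (s.toNat.toPNat h))
  else if h : 0 < (-s).toNat then pPerp K ((-s).toNat.toPNat h) else 0

theorem mode_pos (K : Type*) [Field K] (i : ℕ+) :
    mode K (i : ℕ) = LinearMap.mulLeft K (X i : SymFun K) := by
  rw [mode, dif_pos (by simp)]
  congr 2

theorem mode_neg (K : Type*) [Field K] (i : ℕ+) : mode K (-(i : ℕ)) = pPerp K i := by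
  have := i.pos
  rw [mode, dif_neg (by omega), dif_pos (by omega)]
  congr 1
  exact PNat.coe_injective (by change (- -((i : ℕ) : ℤ)).toNat = i; simp)

theorem mode_zero (K : Type*) [Field K] : mode K 0 = 0 := by simp [mode]

theorem int_cases_pnat {motive : ℤ → Prop} (pos : ∀ i : ℕ+, motive (i : ℕ))
    (neg : ∀ i : ℕ+, motive (-(i : ℕ))) (zero : motive 0) (s : ℤ) : motive s := by
  rcases lt_trichotomy s 0 with h | rfl | h
  · have := neg ⟨(-s).toNat, by omega⟩
    simpa [Int.toNat_of_nonneg (show 0 ≤ -s by omega)] using this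
  · exact zero
  · have := pos ⟨s.toNat, by omega⟩
    simpa [Int.toNat_of_nonneg h.le] using this

/-- The rules for p_i and p_i^⊥ become uniform in the sign of s, and this is the only form used
later. -/
theorem mode_lie_normalPow (K : Type*) [Field K] [CharZero K] (s r : ℤ) (N : ℕ) :
    ⁅mode K s, normalPow K r N⁆ = (-(s : K) * (N : K)) • normalPow K (r + s) (N - 1) := by
  induction s using int_cases_pnat with
  | pos i =>
    rw [mode_pos, Ring.lie_def, ← neg_sub, ← Ring.lie_def, normalPow_X, Int.cast_natCast]
    module
  | neg i =>
    rw [mode_neg, pPerp_normalPow]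
    simp [sub_eq_add_neg]
  | zero => simp [mode_zero, Ring.lie_def]

/-- For N = 1 only α = 0 and partitions with one part contribute, and the power of z selects at most
one of these terms. -/
theorem normalPow_one (K : Type*) [Field K] [CharZero K] (s : ℤ) :
    normalPow K s 1 = mode K s := by
  have h1 : ∀ i : ℕ+, psumPow K 1 ((i : ℕ) : ℤ) = X i := by
    intro i
    rw [psumPow, if_pos (by omega), pow_one, psumSeries, PowerSeries.coeff_mk, dif_pos (by simp)]
    rfl
  have h2 : ∀ s : ℤ, s ≤ 0 → psumPow K 1 s = 0 := by
    intro s hs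
    rw [psumPow]
    split_ifs with h
    · rw [pow_one, psumSeries, PowerSeries.coeff_mk, dif_neg (by omega)]
    · rfl
  have harr : ∀ b : ℕ+, arrangements K (Finsupp.single b 1) = 1 := by
    intro b
    have := arrangements_add_single K 0 b
    simpa [arrangements_zero] using this
  refine LinearMap.ext fun f => ?_
  have hne : ∀ (α : Part), α ≠ 0 → (∀ b, α = Finsupp.single b 1 → s + (b : ℕ) ≠ 0) →
      (((1 : ℕ).choose α.degree : K) * arrangements K α) • psumPow K (1 - α.degree) (s + size α) *
        pPerpPart K α f = 0 := by
    intro α h0 hb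
    obtain ⟨β, i, rfl⟩ := exists_eq_add_single h0
    rcases eq_or_ne β 0 with rfl | hβ
    · have := hb i (zero_add _)
      rw [zero_add]
      have e : size (Finsupp.single i 1) = i := by simpa [size_zero] using size_add_single 0 i
      simp [psumPow_zero, e, this]
    · have : (1 : ℕ) < (β + Finsupp.single i 1 : Part).degree := by
        have : β.degree ≠ 0 := fun h => hβ ((Finsupp.degree_eq_zero_iff β).mp h)
        simp; omega
      rw [Nat.choose_eq_zero_of_lt this]
      simp
  have hzero : (((1 : ℕ).choose (Finsupp.degree (0 : Part)) : K) * arrangements K 0) •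
      psumPow K (1 - Finsupp.degree (0 : Part)) (s + size 0) * pPerpPart K 0 f =
      psumPow K 1 s * f := by
    simp [arrangements_zero, size_zero, pPerpPart_zero]
  rw [normalPow, normalOp_apply]
  induction s using int_cases_pnat with
  | pos i =>
    rw [finsum_eq_single _ (0 : Part), hzero, h1, mode_pos]
    · rfl
    · exact fun α hα => hne α hα fun b _ => by have := b.pos; omega
  | neg i =>
    rw [finsum_eq_single _ (Finsupp.single i 1 : Part), mode_neg]
    · have e : size (Finsupp.single i 1) = i := by simpa [size_zero] using size_add_single 0 i
      simp [harr, psumPow_zero, e, pPerpPart_single]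
    · intro α hα
      rcases eq_or_ne α 0 with rfl | h0
      · rw [hzero, h2 _ (by omega), zero_mul]
      · refine hne α h0 fun b hb hs => hα ?_
        rw [hb]
        congr 1
        exact PNat.coe_injective (by omega)
  | zero =>
    rw [finsum_eq_single _ (0 : Part), hzero, h2 _ le_rfl, mode_zero]
    · simp
    · exact fun α hα => hne α hα fun b _ => by have := b.pos; omega

/-! ### The filtration of an algebra by iterated commutators -/

section LieFilt

variable {K A : Type*} [Field K] [Ring A] [Algebra K A]

theorem comm_swap (x y : A) : ⁅x, y⁆ = -⁅y, x⁆ := by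
  simp only [Ring.lie_def, neg_sub]

theorem comm_leibniz (x y z : A) : ⁅x, ⁅y, z⁆⁆ = ⁅⁅x, y⁆, z⁆ + ⁅y, ⁅x, z⁆⁆ := by
  simp only [Ring.lie_def]; noncomm_ring

theorem comm_add (x y z : A) : ⁅x, y + z⁆ = ⁅x, y⁆ + ⁅x, z⁆ := by
  simp only [Ring.lie_def]; noncomm_ring

theorem comm_sub (x y z : A) : ⁅x, y - z⁆ = ⁅x, y⁆ - ⁅x, z⁆ := by
  simp only [Ring.lie_def]; noncomm_ring

theorem comm_mul (x y z : A) : ⁅x, y * z⁆ = ⁅x, y⁆ * z + y * ⁅x, z⁆ := by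
  simp only [Ring.lie_def]; noncomm_ring

theorem comm_smul (a : K) (x y : A) : ⁅x, a • y⁆ = a • ⁅x, y⁆ := by
  simp only [Ring.lie_def, mul_smul_comm, smul_mul_assoc, smul_sub]

theorem smul_comm_lie (a : K) (x y : A) : ⁅a • x, y⁆ = a • ⁅x, y⁆ := by
  simp only [Ring.lie_def, mul_smul_comm, smul_mul_assoc, smul_sub]

theorem comm_zero (x : A) : ⁅x, (0 : A)⁆ = 0 := by
  simp [Ring.lie_def]

theorem zero_comm (x : A) : ⁅(0 : A), x⁆ = 0 := by
  simp [Ring.lie_def]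

variable (K) in
/-- Elements that vanish after any `n` commutators with the elements `q s`. -/
def lieFilt {ι : Type*} (q : ι → A) : ℕ → Submodule K A
  | 0 => ⊥
  | n + 1 =>
    { carrier := {x | ∀ s, ⁅q s, x⁆ ∈ lieFilt q n}
      add_mem' := fun hx hy s => by rw [comm_add]; exact add_mem (hx s) (hy s)
      zero_mem' := fun s => by rw [comm_zero]; exact zero_mem _
      smul_mem' := fun a x hx s => by rw [comm_smul]; exact Submodule.smul_mem _ _ (hx s) }

variable {ι : Type*} {q : ι → A}

theorem mem_lieFilt_zero {x : A} : x ∈ lieFilt K q 0 ↔ x = 0 := Iff.rfl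

theorem lieFilt_mono {m n : ℕ} (h : m ≤ n) : lieFilt K q m ≤ lieFilt K q n := by
  refine monotone_nat_of_le_succ (f := lieFilt K q) (fun n => ?_) h
  induction n with
  | zero => exact bot_le
  | succ n ih => exact fun x hx s => ih (hx s)

/-- If only central elements commute with all `q s`, the commutator lowers the degree by two. -/
theorem comm_mem_lieFilt (hq : ∀ x : A, (∀ s, ⁅q s, x⁆ = 0) → ∀ y : A, ⁅x, y⁆ = 0) :
    ∀ (a b : ℕ) (x y : A), x ∈ lieFilt K q a → y ∈ lieFilt K q b →
      ⁅x, y⁆ ∈ lieFilt K q (a + b - 3)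
  | 0, b, x, y, hx, _ => by
    rw [mem_lieFilt_zero.mp hx, zero_comm]; exact zero_mem _
  | a, 0, x, y, _, hy => by
    rw [mem_lieFilt_zero.mp hy, comm_zero]; exact zero_mem _
  | 1, b, x, y, hx, _ => by
    rw [hq x hx]; exact zero_mem _
  | a, 1, x, y, _, hy => by
    rw [comm_swap, hq y hy, neg_zero]; exact zero_mem _
  -- The Jacobi identity moves the bracket with `q s` into one argument, lowering a + b by one;
  -- membership at level n + 1 asks for exactly such brackets.
  | a + 2, b + 2, x, y, hx, hy => by
    have e : a + 2 + (b + 2) - 3 = (a + b) + 1 := by omega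
    rw [e]
    intro s
    rw [comm_leibniz]
    refine add_mem ?_ ?_
    · have := comm_mem_lieFilt hq (a + 1) (b + 2) _ y (hx s) hy
      rwa [show a + 1 + (b + 2) - 3 = a + b by omega] at this
    · have := comm_mem_lieFilt hq (a + 2) (b + 1) x _ hx (hy s)
      rwa [show a + 2 + (b + 1) - 3 = a + b by omega] at this
termination_by a b => a + b

/-- A family `B r k` of elements with `B s 0 = q s` and `[q s, B r k] = -k s B (r + s) (k - 1)`
satisfies the relations of the Poisson algebra of functions on a cylinder, up to terms of lower
order. -/
theorem comm_family_mem_lieFilt {q : ℤ → A} (B : ℤ → ℕ → A) (hB : ∀ s, B s 0 = q s)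
    (hqB : ∀ s r k, ⁅q s, B r (k + 1)⁆ = (-(s : K) * ((k + 1 : ℕ) : K)) • B (r + s) k) :
    ∀ (j k : ℕ) (s r : ℤ),
      ⁅B s (j + 1), B r k⁆ - (((j + 1 : ℕ) : K) * (r : K) - (k : K) * (s : K)) • B (r + s) (j + k)
        ∈ lieFilt K q (j + 1 + k)
  | j, 0, s, r => by
    have : ⁅B s (j + 1), B r 0⁆ = (((j + 1 : ℕ) : K) * (r : K)) • B (r + s) j := by
      rw [comm_swap, hB, hqB, ← neg_smul, add_comm s r]
      congr 1
      ring
    rw [this]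
    simp
  -- For first index 1 the bracket with `q t` turns `B s 1` into a multiple of a mode, whose bracket
  -- with `B r (k + 1)` is known exactly.
  | 0, k + 1, s, r => by
    have e : 0 + 1 + (k + 1) = k + 1 + 1 := by omega
    rw [e]
    intro t
    have h1 : ⁅⁅q t, B s (0 + 1)⁆, B r (k + 1)⁆ =
        ((t : K) * ((s + t : ℤ) : K) * ((k + 1 : ℕ) : K)) • B (r + s + t) k := by
      rw [hqB, smul_comm_lie, hB, hqB, smul_smul, add_assoc r]
      congr 1
      push_cast
      ring
    have h2 := comm_family_mem_lieFilt B hB hqB 0 k s (r + t)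
    have h3 := Submodule.smul_mem _ (-(t : K) * ((k + 1 : ℕ) : K)) h2
    rw [show 0 + 1 + k = k + 1 by omega] at h3
    convert h3 using 1
    rw [comm_sub, comm_leibniz, h1, hqB, comm_smul, comm_smul, add_right_comm r t s]
    simp only [zero_add]
    rw [hqB, smul_sub]
    push_cast
    module
  | j + 1, k + 1, s, r => by
    have e : j + 1 + 1 + (k + 1) = j + k + 2 + 1 := by omega
    rw [e]
    intro t
    have h1 := comm_family_mem_lieFilt B hB hqB j (k + 1) (s + t) r
    have h2 := comm_family_mem_lieFilt B hB hqB (j + 1) k s (r + t)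
    -- By Jacobi, the bracket of the claim with `q t` is this combination of two smaller instances;
    -- their t² contributions cancel.
    have h3 := add_mem (Submodule.smul_mem _ (-(t : K) * ((j + 1 + 1 : ℕ) : K)) h1)
      (Submodule.smul_mem _ (-(t : K) * ((k + 1 : ℕ) : K))
        (lieFilt_mono (show j + 1 + 1 + k ≤ j + 1 + (k + 1) by omega) h2))
    rw [show j + 1 + (k + 1) = j + k + 2 by omega] at h3
    convert h3 using 1
    rw [comm_sub, comm_leibniz, hqB, hqB, comm_smul, comm_smul, smul_comm_lie,
      show j + 1 + (k + 1) = j + k + 1 + 1 by omega, hqB,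
      show j + 1 + k = j + k + 1 by omega, show j + (k + 1) = j + k + 1 by omega,
      add_right_comm r t s, ← add_assoc r s t]
    push_cast
    module
termination_by j k => j + k

end LieFilt

/-! ### The commutator filtration and the total degree. -/

theorem lie_mode_mulLeft {K : Type*} [Field K] (A : Module.End K (SymFun K)) (i : ℕ+)
    (f : SymFun K) (h : ⁅mode K (i : ℕ), A⁆ = 0) : A (X i * f) = X i * A f := by
  have := LinearMap.congr_fun h f
  rw [mode_pos, Ring.lie_def, LinearMap.sub_apply, LinearMap.zero_apply, sub_eq_zero] at this
  exact this.symm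

/-- An operator commuting with all `p_i` and `p_i^⊥` is a scalar. -/
theorem eq_smul_one_of_mode_lie_eq_zero {K : Type*} [Field K] [CharZero K]
    (A : Module.End K (SymFun K)) (h : ∀ s, ⁅mode K s, A⁆ = 0) :
    ∃ r : K, ∀ f, A f = r • f := by
  have h1 : A 1 = C (constantCoeff (A 1)) := by
    refine eq_C_of_pPerp_eq_zero K _ fun i => ?_
    have := LinearMap.congr_fun (h (-(i : ℕ))) 1
    rw [mode_neg, Ring.lie_def, LinearMap.sub_apply, LinearMap.zero_apply, Module.End.mul_apply,
      Module.End.mul_apply, pPerp_one, map_zero, sub_zero] at this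
    exact this
  refine ⟨constantCoeff (A 1), fun f => ?_⟩
  induction f using MvPolynomial.induction_on with
  | C r =>
    have : (C r : SymFun K) = r • 1 := by rw [smul_eq_C_mul, mul_one]
    rw [this, map_smul, smul_comm]
    congr 1
    conv_lhs => rw [h1]
    rw [smul_eq_C_mul, mul_one]
  | add p q hp hq => rw [map_add, hp, hq, smul_add]
  | mul_X p i hp => rw [mul_comm, lie_mode_mulLeft A i p (h _), hp, mul_smul_comm]

/-- This is the centrality hypothesis that `comm_mem_lieFilt` needs. -/
theorem lie_eq_zero_of_mode_lie_eq_zero {K : Type*} [Field K] [CharZero K]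
    (A : Module.End K (SymFun K)) (h : ∀ s, ⁅mode K s, A⁆ = 0) (B : Module.End K (SymFun K)) :
    ⁅A, B⁆ = 0 := by
  obtain ⟨r, hr⟩ := eq_smul_one_of_mode_lie_eq_zero A h
  refine LinearMap.ext fun f => ?_
  rw [Ring.lie_def, LinearMap.sub_apply, Module.End.mul_apply, Module.End.mul_apply, hr, hr,
    map_smul, sub_self, LinearMap.zero_apply]

theorem normalOp_zero (K : Type*) [Field K] : normalOp K 0 = 0 := by
  refine LinearMap.ext fun f => ?_
  simp [normalOp_apply]

theorem normalOp_add (K : Type*) [Field K] (c d : Part → SymFun K) :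
    normalOp K (c + d) = normalOp K c + normalOp K d := by
  refine LinearMap.ext fun f => ?_
  rw [LinearMap.add_apply, normalOp_apply, normalOp_apply, normalOp_apply,
    ← finsum_add_distrib (normal_finite K _ _) (normal_finite K _ _)]
  simp [add_mul]

theorem normalCoeff_zero (K : Type*) [Field K] [CharZero K] : normalCoeff K 0 = 0 := by
  rw [← normalOp_zero, normalCoeff_normalOp]

theorem normalCoeff_add (K : Type*) [Field K] [CharZero K] (A B : Module.End K (SymFun K)) :
    normalCoeff K (A + B) = normalCoeff K A + normalCoeff K B := by
  conv_lhs => rw [← normalOp_normalCoeff K A, ← normalOp_normalCoeff K B, ← normalOp_add,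
    normalCoeff_normalOp]

theorem degreePart_add (K : Type*) [Field K] [CharZero K] (d : ℕ)
    (A B : Module.End K (SymFun K)) :
    degreePart K d (A + B) = degreePart K d A + degreePart K d B := by
  rw [degreePart, degreePart, degreePart, ← normalOp_add, normalCoeff_add]
  congr 1
  funext α
  by_cases h : α.degree ≤ d <;> simp [h]

theorem degreePart_smul (K : Type*) [Field K] [CharZero K] (d : ℕ) (a : K)
    (A : Module.End K (SymFun K)) : degreePart K d (a • A) = a • degreePart K d A := by
  have h : normalCoeff K (a • A) = fun α => a • normalCoeff K A α := by
    conv_lhs => rw [← normalOp_normalCoeff K A, smul_normalOp, normalCoeff_normalOp]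
  rw [degreePart, degreePart, smul_normalOp, h]
  congr 1
  funext α
  by_cases h : α.degree ≤ d <;> simp [h]

/-- The filtration by commutators bounds the total degree of an operator. -/
theorem homogeneousComponent_normalCoeff_eq_zero {K : Type*} [Field K] [CharZero K] (d : ℕ)
    (A : Module.End K (SymFun K)) (hA : A ∈ lieFilt K (mode K) d) (n : ℕ) (α : Part)
    (h : d ≤ n + α.degree) : homogeneousComponent n (normalCoeff K A α) = 0 := by
  induction d generalizing A n α with
  | zero =>
    rw [mem_lieFilt_zero.mp hA, normalCoeff_zero]
    simp
  | succ d ih =>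
    cases n with
    -- In positive degree n + 1 the component is killed by every p_i^⊥, hence is a constant, hence
    -- 0.
    | succ n =>
      have h1 : ∀ i, pPerp K i (homogeneousComponent (n + 1) (normalCoeff K A α)) = 0 := by
        intro i
        have := hA (-(i : ℕ))
        rw [mode_neg] at this
        rw [pPerp_homogeneousComponent, ← normalCoeff_lie_pPerp]
        exact ih _ this n α (by omega)
      rw [eq_C_of_pPerp_eq_zero K _ h1, constantCoeff_eq, coeff_homogeneousComponent,
        if_neg (by simp), C_0]
    -- In degree 0 differentiation gives nothing; instead the bracket with p_i removes a part i from
    -- α, which is nonempty by the bound on d.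
    | zero =>
      have h0 : α ≠ 0 := by rintro rfl; simp at h
      obtain ⟨β, i, rfl⟩ := exists_eq_add_single h0
      have h1 := hA (i : ℕ)
      rw [mode_pos] at h1
      have h2 : ⁅A, LinearMap.mulLeft K (X i : SymFun K)⁆ ∈ lieFilt K (mode K) d := by
        rw [Ring.lie_def, ← neg_sub, ← Ring.lie_def]
        exact neg_mem h1
      have h3 := ih _ h2 0 β (by simp at h; omega)
      rw [normalCoeff_lie_X, map_smul] at h3
      refine (smul_eq_zero.mp h3).resolve_left (mul_ne_zero ?_ ?_)
      · exact_mod_cast i.ne_zero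
      · exact Nat.cast_ne_zero.mpr (Nat.succ_ne_zero _)

theorem degreePart_eq_zero {K : Type*} [Field K] [CharZero K] {d e : ℕ}
    {A : Module.End K (SymFun K)} (hA : A ∈ lieFilt K (mode K) d) (h : d ≤ e) :
    degreePart K e A = 0 := by
  rw [degreePart, ← normalOp_zero]
  congr 1
  funext α
  split_ifs with h1
  · exact homogeneousComponent_normalCoeff_eq_zero d A hA _ α (by omega)
  · rfl

theorem degreePart_normalPow (K : Type*) [Field K] [CharZero K] (r : ℤ) (N : ℕ) :
    degreePart K N (normalPow K r N) = normalPow K r N := by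
  rw [degreePart, normalPow, normalCoeff_normalOp]
  congr 1
  funext α
  split_ifs with h
  · rw [map_smul, homogeneousComponent_of_mem (m := N - α.degree)
      ((mem_homogeneousSubmodule _ _).mpr (psumPow_isHomogeneous K _ _)), if_pos rfl]
  · rw [Nat.choose_eq_zero_of_lt (by omega)]
    simp

/-! ### The operators `B_{r,k}` and the cut-and-join operator -/

/-- The coefficient of `z^r` in the normally ordered `(∑ p_i z^i + ∑ p_i^⊥ z^{-i})^{k+1} / (k+1)`. -/
noncomputable def leading (K : Type*) [Field K] (r : ℤ) (k : ℕ) : Module.End K (SymFun K) :=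
  ((k + 1 : ℕ) : K)⁻¹ • normalPow K r (k + 1)

theorem leading_zero (K : Type*) [Field K] [CharZero K] (s : ℤ) : leading K s 0 = mode K s := by
  rw [leading, zero_add, normalPow_one]
  simp

/-- The normalisation 1/(k+1) is chosen so that this matches the hypothesis of
`comm_family_mem_lieFilt`. -/
theorem mode_lie_leading (K : Type*) [Field K] [CharZero K] (s r : ℤ) (k : ℕ) :
    ⁅mode K s, leading K r (k + 1)⁆ = (-(s : K) * ((k + 1 : ℕ) : K)) • leading K (r + s) k := by
  have h1 : ((k + 1 + 1 : ℕ) : K) ≠ 0 := Nat.cast_ne_zero.mpr (Nat.succ_ne_zero _)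
  have h2 : ((k + 1 : ℕ) : K) ≠ 0 := Nat.cast_ne_zero.mpr (Nat.succ_ne_zero _)
  rw [leading, leading, comm_smul (A := Module.End K (SymFun K)), mode_lie_normalPow, smul_smul,
    smul_smul, Nat.add_sub_cancel]
  congr 1
  field_simp

/-- The Heisenberg relation, read off from the case N = 1 of the bracket with φ^N. -/
theorem mode_lie_mode (K : Type*) [Field K] [CharZero K] (s r : ℤ) :
    ⁅mode K s, mode K r⁆ = (if r + s = 0 then -(s : K) else 0) • 1 := by
  rw [← normalPow_one K r, mode_lie_normalPow, Nat.sub_self, normalPow_zero]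
  split_ifs <;> simp

/-- Each bracket lowers the power k + 1 of φ by one; a scalar remains after k + 1 brackets and one
more kills it. -/
theorem leading_mem_lieFilt (K : Type*) [Field K] [CharZero K] (r : ℤ) (k : ℕ) :
    leading K r k ∈ lieFilt K (mode K) (k + 2) := by
  induction k generalizing r with
  | zero =>
    intro s t
    rw [leading_zero, mode_lie_mode, comm_smul (A := Module.End K (SymFun K)), Ring.lie_def,
      mul_one, one_mul, sub_self, smul_zero]
    exact zero_mem _
  | succ k ih =>
    intro s
    rw [mode_lie_leading]
    exact Submodule.smul_mem _ _ (ih _)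

/-- The cut-and-join operator `(1/2) ∑ (p_i p_j p_{i+j}^⊥ + p_{i+j} p_i^⊥ p_j^⊥)`. -/
noncomputable def cutJoin (K : Type*) [Field K] : Module.End K (SymFun K) :=
  (2 : K)⁻¹ • leading K 0 2

theorem mode_lie_cutJoin (K : Type*) [Field K] [CharZero K] (s : ℤ) :
    ⁅mode K s, cutJoin K⁆ = (-(s : K)) • leading K s 1 := by
  rw [cutJoin, comm_smul (A := Module.End K (SymFun K)), mode_lie_leading, smul_smul, zero_add]
  congr 1
  push_cast
  field_simp

/-- The iterated commutators of the cut-and-join operator with `p_1`. -/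
noncomputable def contentOp (K : Type*) [Field K] : ℕ → Module.End K (SymFun K)
  | 0 => LinearMap.mulLeft K (X 1)
  | k + 1 => ⁅cutJoin K, contentOp K k⁆

/-- By induction: the old error loses nothing beyond the expected order under [`cutJoin`, ·], and
the bracket of `cutJoin` with B_{1,k} has top term B_{1,k+1}. -/
theorem contentOp_sub_leading_mem (K : Type*) [Field K] [CharZero K] (k : ℕ) :
    contentOp K k - leading K 1 k ∈ lieFilt K (mode K) (k + 1) := by
  induction k with
  | zero =>
    have : contentOp K 0 - leading K 1 0 = 0 := by
      rw [leading_zero, contentOp, sub_eq_zero]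
      exact (mode_pos K 1).symm
    rw [this]
    exact zero_mem _
  | succ k ih =>
    -- The index 4 is the filtration level of B_{0,2}.
    have h1 := comm_mem_lieFilt (A := Module.End K (SymFun K)) (q := mode K)
      lie_eq_zero_of_mode_lie_eq_zero 4 (k + 1) (cutJoin K) _
      (Submodule.smul_mem _ _ (leading_mem_lieFilt K 0 2)) ih
    have h2 := Submodule.smul_mem _ ((2 : K)⁻¹)
      (comm_family_mem_lieFilt (A := Module.End K (SymFun K)) (leading K) (leading_zero K)
        (mode_lie_leading K) 1 k 0 1)
    rw [show 4 + (k + 1) - 3 = k + 2 by omega] at h1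
    rw [show 1 + 1 + k = k + 2 by omega] at h2
    convert add_mem h1 h2 using 1
    rw [comm_sub (A := Module.End K (SymFun K)), contentOp, cutJoin,
      smul_comm_lie (A := Module.End K (SymFun K)), smul_comm_lie (A := Module.End K (SymFun K)),
      smul_sub, smul_smul, add_zero, add_comm 1 k]
    -- With s = 0 and r = 1 the structure constant jr - ks is 2, cancelling the 1/2 in `cutJoin`.
    have : (2 : K)⁻¹ * (((1 + 1 : ℕ) : K) * ((1 : ℤ) : K) - (k : K) * ((0 : ℤ) : K)) = 1 := by
      push_cast
      norm_num
    rw [this]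
    module

/-! ### Complete symmetric functions -/

theorem complete_succ (K : Type*) [Field K] [CharZero K] (n : ℕ) :
    ((n + 1 : ℕ) : K) • complete K (n + 1) =
      ∑ i ∈ Finset.range (n + 1), X (Nat.succPNat i) * complete K (n - i) := by
  have h : ((n : K) + 1) ≠ 0 := by exact_mod_cast (Nat.succ_ne_zero n)
  rw [complete, smul_eq_C_mul, ← mul_assoc, ← C_mul, Nat.cast_add, Nat.cast_one,
    mul_inv_cancel₀ h, C_1, one_mul, Finset.sum_range]

theorem completeInt_natCast (K : Type*) [Field K] (n : ℕ) :
    completeInt K (n : ℤ) = complete K n := by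
  simp [completeInt]

theorem completeInt_of_neg (K : Type*) [Field K] {n : ℤ} (h : n < 0) : completeInt K n = 0 := by
  rw [completeInt, if_neg (by omega)]

theorem completeInt_zero (K : Type*) [Field K] : completeInt K 0 = 1 := by
  simp [completeInt, complete]

/-- Newton's identity `n h_n = ∑_{j ≥ 1} p_j h_{n-j}`. -/
theorem smul_completeInt (K : Type*) [Field K] [CharZero K] (n : ℤ) (N : ℕ) (h : n ≤ N) :
    (n : K) • completeInt K n =
      ∑ j ∈ Finset.range N, X (Nat.succPNat j) * completeInt K (n - 1 - j) := by
  rcases lt_or_ge n 0 with hn | hn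
  · rw [completeInt_of_neg K hn, smul_zero]
    refine (Finset.sum_eq_zero fun j _ => ?_).symm
    rw [completeInt_of_neg K (by omega), mul_zero]
  obtain ⟨m, rfl⟩ := Int.eq_ofNat_of_zero_le hn
  have hs : ∑ j ∈ Finset.range m, X (Nat.succPNat j) * completeInt K ((m : ℤ) - 1 - j) =
      ∑ j ∈ Finset.range N, X (Nat.succPNat j) * completeInt K ((m : ℤ) - 1 - j) := by
    refine Finset.sum_subset (Finset.range_subset_range.mpr (by omega)) fun j _ hj => ?_
    rw [Finset.mem_range] at hj
    rw [completeInt_of_neg K (by omega), mul_zero]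
  rw [← hs]
  cases m with
  | zero => simp
  | succ m =>
    rw [completeInt_natCast, Int.cast_natCast, complete_succ]
    refine Finset.sum_congr rfl fun j hj => ?_
    rw [Finset.mem_range] at hj
    rw [← completeInt_natCast]
    congr 2
    omega

/-- Strong induction through Newton's identity for n h_n: the one extra term, from p_i^⊥ hitting
p_i, is i h_{n-i}, which completes (n - i) h_{n-i} to n h_{n-i}. -/
theorem pPerp_completeInt (K : Type*) [Field K] [CharZero K] (i : ℕ+) (n : ℤ) :
    pPerp K i (completeInt K n) = completeInt K (n - (i : ℕ)) := by
  have hi := i.pos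
  rcases lt_or_ge n 0 with hn | hn
  · rw [completeInt_of_neg K hn, completeInt_of_neg K (by omega), map_zero]
  obtain ⟨m, rfl⟩ := Int.eq_ofNat_of_zero_le hn
  induction m using Nat.strong_induction_on with
  | _ m ih =>
    rcases Nat.eq_zero_or_pos m with rfl | hm
    · rw [completeInt_of_neg K (n := ((0 : ℕ) : ℤ) - (i : ℕ)) (by push_cast; omega), Nat.cast_zero,
        completeInt_zero, pPerp_one]
    have hm0 : ((m : ℤ) : K) ≠ 0 := by
      rw [Int.cast_natCast]; exact Nat.cast_ne_zero.mpr hm.ne'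
    refine smul_right_injective _ hm0 ?_
    simp only
    rw [← map_smul, smul_completeInt K m (m + i) (by omega), map_sum]
    have h1 := smul_completeInt K ((m : ℤ) - (i : ℕ)) (m + i) (by omega)
    have h2 : ∀ j ∈ Finset.range (m + (i : ℕ)),
        pPerp K i (X (Nat.succPNat j) * completeInt K ((m : ℤ) - 1 - j)) =
          (if (i : ℕ) = j + 1 then C ((i : ℕ) : K) * completeInt K ((m : ℤ) - (i : ℕ)) else 0) +
            X (Nat.succPNat j) * completeInt K ((m : ℤ) - (i : ℕ) - 1 - j) := by
      intro j _
      rw [pPerp_mul, pPerp_X]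
      congr 1
      · by_cases hij : (i : ℕ) = j + 1
        · rw [if_pos hij, if_pos (PNat.coe_injective hij)]
          congr 2
          omega
        · rw [if_neg hij, if_neg, zero_mul]
          rintro rfl
          exact hij rfl
      · congr 1
        rcases lt_or_ge ((m : ℤ) - 1 - j) 0 with hlt | hge
        · rw [completeInt_of_neg K hlt, map_zero, completeInt_of_neg K (by omega)]
        · obtain ⟨l, hl⟩ := Int.eq_ofNat_of_zero_le hge
          rw [hl, ih l (by omega) (by omega), ← hl]
          congr 1
          omega
    rw [Finset.sum_congr rfl h2, Finset.sum_add_distrib, ← h1,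
      Finset.sum_eq_single ((i : ℕ) - 1)]
    · rw [if_pos (by omega), ← smul_eq_C_mul, ← add_smul]
      congr 1
      push_cast
      ring
    · intro b _ hb
      rw [if_neg (by omega)]
    · intro hb
      exact absurd (Finset.mem_range.mpr (by omega)) hb

theorem constantCoeff_completeInt (K : Type*) [Field K] [CharZero K] (n : ℤ) :
    constantCoeff (completeInt K n) = if n = 0 then 1 else 0 := by
  split_ifs with h
  · rw [h, completeInt_zero, map_one]
  · have h0 : (n : K) ≠ 0 := by exact_mod_cast h
    have := congrArg constantCoeff (smul_completeInt K n n.toNat (by omega))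
    rw [constantCoeff_smul, map_sum, Finset.sum_eq_zero fun j _ => by simp, smul_eq_mul] at this
    exact (mul_eq_zero.mp this).resolve_left h0

/-! ### Bernstein operators -/

/-- The algebra homomorphism `p_i ↦ p_i - u^i`. -/
noncomputable def shift (K : Type*) [Field K] : SymFun K →ₐ[K] Polynomial (SymFun K) :=
  aeval fun i => Polynomial.C (X i) - Polynomial.X ^ (i : ℕ)

theorem shift_X (K : Type*) [Field K] (i : ℕ+) :
    shift K (X i) = Polynomial.C (X i) - Polynomial.X ^ (i : ℕ) := by
  simp [shift]

/-- The linear map `u^i ↦ h_{n+i}`. -/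
noncomputable def completePairing (K : Type*) [Field K] (n : ℤ) :
    Polynomial (SymFun K) →ₗ[SymFun K] SymFun K :=
  Polynomial.lsum fun i => LinearMap.toSpanSingleton (SymFun K) (SymFun K) (completeInt K (n + i))

theorem completePairing_C_mul_X_pow (K : Type*) [Field K] (n : ℤ) (g : SymFun K) (i : ℕ) :
    completePairing K n (Polynomial.C g * Polynomial.X ^ i) = g * completeInt K (n + i) := by
  rw [Polynomial.C_mul_X_pow_eq_monomial, completePairing, Polynomial.lsum_apply,
    Polynomial.sum_monomial_index _ _ (by simp)]
  simp

theorem completePairing_C_mul (K : Type*) [Field K] (n : ℤ) (g : SymFun K)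
    (P : Polynomial (SymFun K)) :
    completePairing K n (Polynomial.C g * P) = g * completePairing K n P := by
  rw [← Polynomial.smul_eq_C_mul, map_smul, smul_eq_mul]

theorem completePairing_X_pow_mul (K : Type*) [Field K] (n : ℤ) (m : ℕ)
    (P : Polynomial (SymFun K)) :
    completePairing K n (Polynomial.X ^ m * P) = completePairing K (n + m) P := by
  induction P using Polynomial.induction_on' with
  | add P Q hP hQ => rw [mul_add, map_add, map_add, hP, hQ]
  | monomial i g =>
    rw [← Polynomial.C_mul_X_pow_eq_monomial, mul_left_comm, ← pow_add,
      completePairing_C_mul_X_pow, completePairing_C_mul_X_pow]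
    push_cast
    rw [add_assoc]

theorem completePairing_eq_sum (K : Type*) [Field K] (n : ℤ) (P : Polynomial (SymFun K)) (N : ℕ)
    (h : P.natDegree < N) :
    completePairing K n P = ∑ k ∈ Finset.range N, P.coeff k * completeInt K (n + k) := by
  conv_lhs => rw [P.as_sum_range_C_mul_X_pow' h]
  rw [map_sum]
  exact Finset.sum_congr rfl fun k _ => completePairing_C_mul_X_pow K n _ k

/-- The Bernstein operator `∑_i (-1)^i h_{n+i} e_i^⊥`. -/
noncomputable def bernstein (K : Type*) [Field K] (n : ℤ) : Module.End K (SymFun K) where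
  toFun f := completePairing K n (shift K f)
  map_add' f g := by rw [map_add, map_add]
  map_smul' r f := by
    rw [smul_eq_C_mul, map_mul, RingHom.id_apply, smul_eq_C_mul, ← completePairing_C_mul]
    congr 2
    simp [shift]

theorem bernstein_apply (K : Type*) [Field K] (n : ℤ) (f : SymFun K) :
    bernstein K n f = completePairing K n (shift K f) := rfl

theorem bernstein_one (K : Type*) [Field K] (n : ℤ) : bernstein K n 1 = completeInt K n := by
  have := completePairing_C_mul_X_pow K n 1 0
  simpa [bernstein_apply] using this

theorem bernstein_X_mul (K : Type*) [Field K] (n : ℤ) (i : ℕ+) (f : SymFun K) :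
    bernstein K n (X i * f) = X i * bernstein K n f - bernstein K (n + (i : ℕ)) f := by
  rw [bernstein_apply, map_mul, shift_X, sub_mul, map_sub, completePairing_C_mul,
    completePairing_X_pow_mul]
  rfl

/-- The substitution alters p_i only by u^i, on which p_i^⊥ vanishes. -/
theorem coeff_shift_pPerp (K : Type*) [Field K] (i : ℕ+) (f : SymFun K) (k : ℕ) :
    (shift K (pPerp K i f)).coeff k = pPerp K i ((shift K f).coeff k) := by
  induction f using MvPolynomial.induction_on generalizing k with
  | C r =>
    have : shift K (C r) = Polynomial.C (C r) := by simp [shift]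
    rw [pPerp_C, map_zero, Polynomial.coeff_zero, this, Polynomial.coeff_C]
    split_ifs <;> simp [pPerp_C]
  | add p q hp hq => rw [map_add, map_add, map_add, Polynomial.coeff_add, Polynomial.coeff_add,
      map_add, hp, hq]
  | mul_X p j hp =>
    have h1 : ∀ g : SymFun K, ∀ k, (shift K (g * X j)).coeff k =
        (shift K g).coeff k * X j - if (j : ℕ) ≤ k then (shift K g).coeff (k - j) else 0 := by
      intro g k
      rw [map_mul, shift_X, mul_sub, Polynomial.coeff_sub, Polynomial.coeff_mul_C,
        Polynomial.coeff_mul_X_pow']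
    have h2 : shift K (p * pPerp K i (X j)) = shift K p * Polynomial.C (pPerp K i (X j)) := by
      rw [map_mul, pPerp_X]
      split_ifs <;> simp [shift]
    rw [h1, pPerp_mul, map_add, Polynomial.coeff_add, h1, h2, Polynomial.coeff_mul_C, map_sub,
      pPerp_mul, hp, apply_ite (pPerp K i), map_zero, hp]
    ring

theorem pPerp_bernstein (K : Type*) [Field K] [CharZero K] (n : ℤ) (i : ℕ+) (f : SymFun K) :
    pPerp K i (bernstein K n f) =
      bernstein K n (pPerp K i f) + bernstein K (n - (i : ℕ)) f := by
  set N := max (shift K f).natDegree (shift K (pPerp K i f)).natDegree + 1 with hN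
  have h1 : (shift K f).natDegree < N := by omega
  have h2 : (shift K (pPerp K i f)).natDegree < N := by omega
  rw [bernstein_apply, bernstein_apply, bernstein_apply, completePairing_eq_sum K _ _ N h1,
    completePairing_eq_sum K _ _ N h1, completePairing_eq_sum K _ _ N h2, map_sum,
    ← Finset.sum_add_distrib]
  refine Finset.sum_congr rfl fun k _ => ?_
  rw [pPerp_mul, coeff_shift_pPerp, pPerp_completeInt, add_sub_right_comm]

/-- A Bernstein operator is determined by this bracket rule and its constant terms. The case s = 0
is excluded because `mode K 0` is 0. -/
theorem mode_lie_bernstein (K : Type*) [Field K] [CharZero K] (s n : ℤ) (hs : s ≠ 0) :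
    ⁅mode K s, bernstein K n⁆ = bernstein K (n + s) := by
  refine LinearMap.ext fun f => ?_
  induction s using int_cases_pnat with
  | pos i =>
    rw [mode_pos, Ring.lie_def, LinearMap.sub_apply, Module.End.mul_apply, Module.End.mul_apply,
      LinearMap.mulLeft_apply, LinearMap.mulLeft_apply, bernstein_X_mul, sub_sub_cancel]
  | neg i =>
    rw [mode_neg, Ring.lie_def, LinearMap.sub_apply, Module.End.mul_apply, Module.End.mul_apply,
      pPerp_bernstein, add_sub_cancel_left, sub_eq_add_neg]
  | zero => exact absurd rfl hs

/-! ### Jacobi–Trudi determinants -/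

/-- The determinant `det (h_{f_i - i + j})` of size `N`. -/
noncomputable def jacobiTrudi (K : Type*) [Field K] (N : ℕ) (f : ℕ → ℤ) : SymFun K :=
  Matrix.det (Matrix.of fun i j : Fin N => completeInt K (f i - (i : ℤ) + (j : ℤ)))

/-- The substitution multiplies the generating series exp(∑ p_i z^i / i) by exp(-∑ (uz)^i / i) = 1 -
uz. The proof replaces exponentials by Newton's identity. -/
theorem shift_completeInt (K : Type*) [Field K] [CharZero K] (n : ℤ) :
    shift K (completeInt K n) =
      Polynomial.C (completeInt K n) - Polynomial.X * Polynomial.C (completeInt K (n - 1)) := by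
  rcases lt_or_ge n 0 with hn | hn
  · rw [completeInt_of_neg K hn, completeInt_of_neg K (by omega)]
    simp
  obtain ⟨m, rfl⟩ := Int.eq_ofNat_of_zero_le hn
  induction m using Nat.strong_induction_on with
  | _ m ih =>
    rcases Nat.eq_zero_or_pos m with rfl | hm
    · rw [completeInt_of_neg K (n := (0 : ℕ) - 1) (by simp)]
      simp [completeInt_zero]
    have hm0 : ((m : ℤ) : K) ≠ 0 := by
      rw [Int.cast_natCast]; exact Nat.cast_ne_zero.mpr hm.ne'
    refine smul_right_injective _ hm0 ?_
    simp only
    have h1 := smul_completeInt K (m : ℤ) m le_rfl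
    have h2 := smul_completeInt K ((m : ℤ) - 1) m (by omega)
    have e1 : ∀ (r : K) (g : SymFun K), r • (Polynomial.C g) = Polynomial.C (r • g) :=
      fun r g => by rw [Polynomial.smul_C]
    rw [← map_smul, h1, map_sum, smul_sub, ← mul_smul_comm, e1, e1, h1,
      show ((m : ℤ) : K) • completeInt K ((m : ℤ) - 1) = (((m : ℤ) - 1 : ℤ) : K) •
        completeInt K ((m : ℤ) - 1) + completeInt K ((m : ℤ) - 1) by push_cast; module, h2]
    -- The cross terms with u^{j+1} are arranged as a difference, so that they telescope in the sum
    -- over j.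
    have h3 : ∀ j ∈ Finset.range m,
        shift K (X (Nat.succPNat j) * completeInt K ((m : ℤ) - 1 - j)) =
          Polynomial.C (X (Nat.succPNat j) * completeInt K ((m : ℤ) - 1 - j)) -
          Polynomial.X * Polynomial.C (X (Nat.succPNat j) * completeInt K ((m : ℤ) - 1 - 1 - j)) +
          (Polynomial.X ^ (j + 1 + 1) * Polynomial.C (completeInt K ((m : ℤ) - 1 - (j + 1 : ℕ))) -
           Polynomial.X ^ (j + 1) * Polynomial.C (completeInt K ((m : ℤ) - 1 - j))) := by
      intro j hj
      rw [Finset.mem_range] at hj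
      have e2 : (m : ℤ) - 1 - j = ((m - 1 - j : ℕ) : ℤ) := by omega
      have e3 : (m : ℤ) - 1 - (j + 1 : ℕ) = (m : ℤ) - 1 - j - 1 := by push_cast; ring
      have e4 : (m : ℤ) - 1 - 1 - j = (m : ℤ) - 1 - j - 1 := by ring
      rw [map_mul, shift_X, e3, e4, e2, ih _ (by omega) (by omega), map_mul, map_mul,
        Nat.succPNat_coe, Nat.succ_eq_add_one]
      ring
    rw [Finset.sum_congr rfl h3, Finset.sum_add_distrib, Finset.sum_sub_distrib,
      Finset.sum_range_sub (fun j : ℕ => Polynomial.X ^ (j + 1) *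
        Polynomial.C (completeInt K ((m : ℤ) - 1 - j))),
      completeInt_of_neg K (n := (m : ℤ) - 1 - m) (by omega), map_sum, map_add, map_sum,
      ← Finset.mul_sum]
    simp only [map_zero, Nat.cast_zero, sub_zero]
    ring

/-- Replace the first row by 1, u, u², …: the map u^j ↦ h_{f_0+j} restores the determinant, while
column operations identify the modified determinant with the shift of the smaller one. -/
theorem jacobiTrudi_succ (K : Type*) [Field K] [CharZero K] (N : ℕ) (f : ℕ → ℤ) :
    jacobiTrudi K (N + 1) f = bernstein K (f 0) (jacobiTrudi K N fun i => f (i + 1)) := by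
  let M : Matrix (Fin (N + 1)) (Fin (N + 1)) (Polynomial (SymFun K)) :=
    Matrix.of (Fin.cons (fun j => Polynomial.X ^ (j : ℕ)) fun i j =>
      Polynomial.C (completeInt K (f (i + 1) - ((i : ℕ) + 1 : ℕ) + (j : ℕ))))
  -- Subtracting u times the preceding column turns the first row into (1, 0, …, 0) and, by
  -- `shift_completeInt`, the other entries into shifted h's.
  let B : Matrix (Fin (N + 1)) (Fin (N + 1)) (Polynomial (SymFun K)) :=
    Matrix.of fun i => Fin.cons (M i 0) fun j => M i j.succ - Polynomial.X * M i j.castSucc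
  have hMB : M.det = B.det := by
    refine Matrix.det_eq_of_forall_col_eq_smul_add_pred (fun _ => Polynomial.X)
      (fun i => rfl) fun i j => ?_
    simp [B]
  have hM : completePairing K (f 0) M.det = jacobiTrudi K (N + 1) f := by
    rw [Matrix.det_succ_row_zero, map_sum, jacobiTrudi, Matrix.det_succ_row_zero]
    refine Finset.sum_congr rfl fun j _ => ?_
    have h1 : (M.submatrix Fin.succ j.succAbove).det = Polynomial.C
        ((Matrix.of fun i j : Fin (N + 1) =>
          completeInt K (f i - (i : ℕ) + (j : ℕ))).submatrix Fin.succ j.succAbove).det := by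
      rw [RingHom.map_det]
      congr 1
    have h2 : (-1 : Polynomial (SymFun K)) ^ (j : ℕ) = Polynomial.C ((-1) ^ (j : ℕ)) := by simp
    rw [h1, h2, show M 0 j = Polynomial.X ^ (j : ℕ) from rfl, mul_comm, mul_left_comm, ← mul_assoc,
      mul_assoc, mul_left_comm, ← mul_assoc, ← map_mul, completePairing_C_mul_X_pow]
    simp
    ring
  have hB : B.det = shift K (jacobiTrudi K N fun i => f (i + 1)) := by
    rw [Matrix.det_succ_row_zero, Finset.sum_eq_single 0]
    · rw [jacobiTrudi, AlgHom.map_det]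
      have : B 0 0 = 1 := by simp [B, M]
      rw [this]
      simp only [Fin.val_zero, pow_zero, one_mul, Fin.succAbove_zero]
      congr 1
      ext1 a b
      simp only [AlgHom.mapMatrix_apply, Matrix.map_apply, Matrix.of_apply, shift_completeInt,
        Matrix.submatrix_apply, B, M, Fin.cons_succ, Fin.val_succ, Fin.val_castSucc]
      have e1 : f (a + 1) - (((a : ℕ) + 1 : ℕ) : ℤ) + (((b : ℕ) + 1 : ℕ) : ℤ) =
          f (a + 1) - (a : ℕ) + (b : ℕ) := by push_cast; ring
      have e2 : f (a + 1) - (((a : ℕ) + 1 : ℕ) : ℤ) + ((b : ℕ) : ℤ) =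
          f (a + 1) - (a : ℕ) + (b : ℕ) - 1 := by push_cast; ring
      rw [e1, e2]
    · intro j _ hj
      obtain ⟨j, rfl⟩ := Fin.exists_succ_eq.mpr hj
      have : B 0 j.succ = 0 := by simp [B, M, pow_succ']
      rw [this]
      simp
    · simp
  rw [← hM, hMB, hB, bernstein_apply]

theorem jacobiTrudi_zero (K : Type*) [Field K] (f : ℕ → ℤ) : jacobiTrudi K 0 f = 1 := by
  simp [jacobiTrudi]

/-! ### Commutation of the cut-and-join operator with the Bernstein operators -/

/-- A family of operators behaving like the Bernstein operators under commutators with all `p_i`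
and `p_i^⊥` vanishes if all its vacuum expectation values vanish. -/
theorem eq_zero_of_mode_lie {K : Type*} [Field K] [CharZero K] (Y : ℤ → Module.End K (SymFun K))
    (hY : ∀ s n, s ≠ 0 → ⁅mode K s, Y n⁆ = Y (n + s)) (h0 : ∀ n, constantCoeff (Y n 1) = 0)
    (n : ℤ) : Y n = 0 := by
  -- As p_i^⊥ kills 1, differentiating `Y n 1` gives `Y (n - i) 1`; every coefficient reduces to a
  -- constant term with another index.
  have h1 : ∀ α n, coeff α (Y n 1) = 0 := by
    intro α
    induction α using part_induction with
    | zero => exact h0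
    | add α i ih =>
      intro n
      have hi := i.pos
      have h := LinearMap.congr_fun (hY (-(i : ℕ)) n (by omega)) 1
      rw [mode_neg, Ring.lie_def, LinearMap.sub_apply, Module.End.mul_apply, Module.End.mul_apply,
        pPerp_one, map_zero, sub_zero] at h
      have h2 := congrArg (coeff α) h
      rw [coeff_pPerp, ih] at h2
      refine (mul_eq_zero.mp h2).resolve_left (mul_ne_zero ?_ ?_)
      · exact Nat.cast_ne_zero.mpr i.ne_zero
      · exact Nat.cast_ne_zero.mpr (Nat.succ_ne_zero _)
  have h2 : ∀ f n, Y n f = 0 := by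
    intro f
    induction f using MvPolynomial.induction_on with
    | C r =>
      intro n
      have : (C r : SymFun K) = r • 1 := by rw [smul_eq_C_mul, mul_one]
      have h3 : Y n 1 = 0 := by ext α; rw [h1, coeff_zero]
      rw [this, map_smul, h3, smul_zero]
    | add p q hp hq => intro n; rw [map_add, hp, hq, add_zero]
    | mul_X p i hp =>
      intro n
      have hi := i.pos
      have h := LinearMap.congr_fun (hY (i : ℕ) n (by omega)) p
      rw [mode_pos, Ring.lie_def, LinearMap.sub_apply, Module.End.mul_apply, Module.End.mul_apply,
        LinearMap.mulLeft_apply, LinearMap.mulLeft_apply, hp, hp, mul_zero, zero_sub,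
        neg_eq_zero] at h
      rw [mul_comm, h]
  exact LinearMap.ext fun f => h2 f n

theorem constantCoeff_normalOp {K : Type*} [Field K] (c : Part → SymFun K)
    (h : ∀ α, constantCoeff (c α) = 0) (f : SymFun K) : constantCoeff (normalOp K c f) = 0 := by
  have := AddMonoidHom.map_finsum (constantCoeff (R := K) (σ := ℕ+)).toAddMonoidHom
    (normal_finite K c f)
  rw [normalOp_apply]
  refine this.trans ?_
  refine (finsum_congr fun α => ?_).trans finsum_zero
  simp [h α]

theorem normalOp_one (K : Type*) [Field K] (c : Part → SymFun K) : normalOp K c 1 = c 0 := by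
  have h : (1 : SymFun K) = monomial 0 1 := rfl
  rw [normalOp_apply, finsum_eq_single _ (0 : Part)]
  · rw [pPerpPart_zero, Module.End.one_apply, mul_one]
  · intro α hα
    rw [h, pPerpPart_monomial_eq_zero K (fun hle => hα (le_antisymm hle (zero_le (a := α)))), mul_zero]

theorem leading_one (K : Type*) [Field K] (r : ℤ) (k : ℕ) :
    leading K r k 1 = ((k + 1 : ℕ) : K)⁻¹ • psumPow K (k + 1) r := by
  rw [leading, LinearMap.smul_apply, normalPow, normalOp_one]
  simp [arrangements_zero, size_zero]

theorem psumPow_eq_zero (K : Type*) [Field K] {j : ℕ} (hj : j ≠ 0) {n : ℤ} (hn : n ≤ 0) :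
    psumPow K j n = 0 := by
  unfold psumPow
  split_ifs with h
  · obtain rfl : n = 0 := le_antisymm hn h
    rw [Int.toNat_zero, PowerSeries.coeff_zero_eq_constantCoeff_apply, map_pow,
      ← PowerSeries.coeff_zero_eq_constantCoeff_apply, psumSeries, PowerSeries.coeff_mk,
      dif_neg (lt_irrefl 0), zero_pow hj]
  · rfl

theorem constantCoeff_psumPow (K : Type*) [Field K] {j : ℕ} (hj : j ≠ 0) (n : ℤ) :
    constantCoeff (psumPow K j n) = 0 := by
  rw [constantCoeff_eq]
  exact (psumPow_isHomogeneous K j n).coeff_eq_zero (by simpa using hj.symm)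

theorem degree_le_size (α : Part) : α.degree ≤ size α := by
  induction α using part_induction with
  | zero => simp
  | add α i ih =>
    have := i.pos
    rw [size_add_single]
    simp
    omega

/-- For r ≥ 0 every term of B_{r,k} carries some p_a on the left: the a's have sum r plus that of
the b's, which is positive if there are no a's to begin with. -/
theorem constantCoeff_leading {K : Type*} [Field K] {r : ℤ} (hr : 0 ≤ r) (k : ℕ) (f : SymFun K) :
    constantCoeff (leading K r k f) = 0 := by
  rw [leading, LinearMap.smul_apply, constantCoeff_smul, normalPow, constantCoeff_normalOp,
    smul_zero]
  intro α
  rw [constantCoeff_smul]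
  rcases lt_trichotomy α.degree (k + 1) with h | h | h
  · rw [constantCoeff_psumPow K (by omega), smul_zero]
  · have := degree_le_size α
    rw [h, Nat.sub_self, psumPow_zero, if_neg (by omega), map_zero, smul_zero]
  · rw [Nat.choose_eq_zero_of_lt h]
    simp

theorem constantCoeff_mode_completeInt (K : Type*) [Field K] [CharZero K] (s n : ℤ) :
    constantCoeff (mode K s (completeInt K n)) = if s < 0 ∧ n + s = 0 then 1 else 0 := by
  induction s using int_cases_pnat with
  | pos i =>
    rw [mode_pos, LinearMap.mulLeft_apply, map_mul, constantCoeff_X, zero_mul, if_neg]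
    omega
  | neg i =>
    have := i.pos
    rw [mode_neg, pPerp_completeInt, constantCoeff_completeInt]
    exact if_congr (by omega) rfl rfl
  | zero => simp [mode_zero]

/-- Each product p_a p_b with a + b = r contributes the constant term of (-1)² h_{n+r}, and there
are r - 1 such ordered pairs. -/
theorem constantCoeff_bernstein_psumPow (K : Type*) [Field K] [CharZero K] (n : ℤ) (r : ℕ)
    (hr : 0 < r) :
    constantCoeff (bernstein K n (psumPow K 2 r)) = if n + r = 0 then ((r : K) - 1) else 0 := by
  have hX : ∀ (l : ℤ) (i : ℕ+), bernstein K l (X i) =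
      X i * completeInt K l - completeInt K (l + (i : ℕ)) := by
    intro l i
    have := bernstein_X_mul K l i 1
    rwa [mul_one, bernstein_one, bernstein_one] at this
  have h1 : ∀ k ∈ Finset.range (r + 1), constantCoeff (bernstein K n
      (PowerSeries.coeff k (psumSeries K) * PowerSeries.coeff (r - k) (psumSeries K))) =
      if k ∈ Finset.Ioo 0 r then (if n + r = 0 then (1 : K) else 0) else 0 := by
    intro k hk
    rw [Finset.mem_range] at hk
    rw [psumSeries, PowerSeries.coeff_mk, PowerSeries.coeff_mk]
    by_cases hk0 : 0 < k
    · by_cases hkr : 0 < r - k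
      · rw [dif_pos hk0, dif_pos hkr, if_pos (Finset.mem_Ioo.mpr ⟨hk0, by omega⟩), bernstein_X_mul,
          map_sub, map_mul, constantCoeff_X, zero_mul, hX, map_sub, map_mul, constantCoeff_X,
          zero_mul, constantCoeff_completeInt, zero_sub, zero_sub, neg_neg]
        refine if_congr ?_ rfl rfl
        change n + ((k : ℕ) : ℤ) + ((r - k : ℕ) : ℤ) = 0 ↔ _
        omega
      · rw [dif_neg hkr, mul_zero, if_neg (by rw [Finset.mem_Ioo]; omega), map_zero, map_zero]
    · rw [dif_neg hk0, zero_mul, if_neg (by rw [Finset.mem_Ioo]; omega), map_zero, map_zero]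
  rw [psumPow, if_pos (by omega), Int.toNat_natCast, pow_two, PowerSeries.coeff_mul,
    Finset.Nat.sum_antidiagonal_eq_sum_range_succ (fun a b =>
      PowerSeries.coeff a (psumSeries K) * PowerSeries.coeff b (psumSeries K)), map_sum, map_sum,
    Finset.sum_congr rfl h1, ← Finset.sum_filter, Finset.sum_const]
  have h2 : (Finset.range r.succ).filter (fun k => k ∈ Finset.Ioo 0 r) = Finset.Ioo 0 r := by
    ext k
    simp
    omega
  rw [h2, Nat.card_Ioo]
  split_ifs
  · rw [nsmul_one, Nat.sub_zero, Nat.cast_sub hr, Nat.cast_one]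
  · rw [smul_zero]

/-- Newton's identity writes n h_n through products p_j h_{n-j}; moving the operator past p_j leaves
p_{m-j}^⊥, and the surviving values j < m add up to m(m-1)/2. -/
theorem constantCoeff_leading_completeInt (K : Type*) [Field K] [CharZero K] (m : ℕ) (hm : 0 < m)
    (n : ℤ) : constantCoeff (leading K (-m) 1 (completeInt K n)) =
      if n = m then ((m : K) - 1) / 2 else 0 := by
  rcases lt_trichotomy n 0 with hn | rfl | hn
  · rw [completeInt_of_neg K hn, map_zero, map_zero, if_neg (by omega)]
  · rw [completeInt_zero, leading_one, psumPow_eq_zero K (by omega) (by omega), smul_zero, map_zero,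
      if_neg (by omega)]
  · have hn0 : (n : K) ≠ 0 := by exact_mod_cast hn.ne'
    obtain ⟨N, rfl⟩ := Int.eq_ofNat_of_zero_le hn.le
    refine mul_left_cancel₀ hn0 ?_
    have h1 : ∀ j ∈ Finset.range N, constantCoeff (leading K (-m) 1
        (X (Nat.succPNat j) * completeInt K ((N : ℤ) - 1 - j))) =
        if j + 1 < m ∧ N = m then ((j : K) + 1) else 0 := by
      intro j _
      have h2 := LinearMap.congr_fun (mode_lie_leading K ((Nat.succPNat j : ℕ) : ℤ) (-m) 0)
        (completeInt K ((N : ℤ) - 1 - j))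
      rw [mode_pos, Ring.lie_def, LinearMap.sub_apply, Module.End.mul_apply, Module.End.mul_apply,
        LinearMap.mulLeft_apply, LinearMap.mulLeft_apply, sub_eq_iff_eq_add', ← sub_eq_iff_eq_add,
        zero_add, LinearMap.smul_apply, leading_zero] at h2
      rw [← h2, map_sub, map_mul, constantCoeff_X, zero_mul, zero_sub, constantCoeff_smul,
        constantCoeff_mode_completeInt, Nat.succPNat_coe]
      by_cases h : j + 1 < m ∧ N = m
      · rw [if_pos h, if_pos (by omega)]
        push_cast
        simp
      · rw [if_neg h, if_neg (by omega), smul_zero, neg_zero]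
    rw [← smul_eq_mul, ← constantCoeff_smul, ← map_smul, smul_completeInt K _ N (by omega), map_sum,
      map_sum, Finset.sum_congr rfl h1]
    by_cases hNm : N = m
    · subst hNm
      obtain ⟨M, rfl⟩ : ∃ M, N = M + 1 := ⟨N - 1, by omega⟩
      have h3 : ∀ M : ℕ, ∑ j ∈ Finset.range M, ((j : K) + 1) = (M + 1) * M / 2 := by
        intro M
        induction M with
        | zero => simp
        | succ M ih => rw [Finset.sum_range_succ, ih]; push_cast; field_simp; ring
      rw [Finset.sum_range_succ, if_neg (by omega), add_zero, if_pos rfl,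
        Finset.sum_congr rfl (g := fun j : ℕ => (j : K) + 1), h3]
      · push_cast
        ring
      · intro j hj
        rw [Finset.mem_range] at hj
        rw [if_pos ⟨by omega, rfl⟩]
    · rw [if_neg (by omega), mul_zero]
      exact Finset.sum_eq_zero fun j _ => if_neg (by omega)

/-! ### Relations with the Bernstein operators. -/

/-- The common shape of the three relations below, differentiated once by ad q. -/
theorem comm_sub_mul_sub {K A : Type*} [Field K] [Ring A] [Algebra K A] (q L b m d : A) (c : K) :
    ⁅q, L * b - b * (L - m) - c • d⁆ = (⁅q, L⁆ * b - b * ⁅q, L⁆) + b * ⁅q, m⁆ +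
      (L * ⁅q, b⁆ - ⁅q, b⁆ * (L - m)) - c • ⁅q, d⁆ := by
  simp only [comm_sub, comm_smul, comm_mul, mul_sub]
  abel

theorem smul_mul_sub_mul_smul {K : Type*} [Field K] (a : K) (x b : Module.End K (SymFun K)) :
    (a • x) * b - b * (a • x) = a • (x * b - b * x) := by
  rw [smul_mul_assoc, mul_smul_comm]
  exact (smul_sub a _ _).symm

/-- Commutation of the Euler operator with the Bernstein operators. -/
theorem euler_mul_bernstein (K : Type*) [Field K] [CharZero K] (n : ℤ) :
    leading K 0 1 * bernstein K n = bernstein K n * leading K 0 1 + (n : K) • bernstein K n := by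
  have key := eq_zero_of_mode_lie (fun n => leading K 0 1 * bernstein K n -
    bernstein K n * (leading K 0 1 - 0) - (n : K) • bernstein K n) ?_ ?_ n
  · rw [sub_zero, sub_sub, sub_eq_zero] at key
    exact key
  · intro s n hs
    have h1 : ⁅mode K s, leading K 0 1⁆ = (-(s : K)) • mode K s := by
      have := mode_lie_leading K s 0 0
      rw [leading_zero, zero_add, zero_add] at this
      simpa using this
    have h2 := mode_lie_bernstein K s n hs
    have h3 : mode K s * bernstein K n - bernstein K n * mode K s = bernstein K (n + s) := h2
    refine (comm_sub_mul_sub (A := Module.End K (SymFun K)) _ _ _ _ _ _).trans ?_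
    rw [h1, h2, comm_zero (A := Module.End K (SymFun K)), smul_mul_sub_mul_smul, h3,
      mul_zero]
    push_cast
    module
  · intro n
    simp only [LinearMap.sub_apply, Module.End.mul_apply, LinearMap.smul_apply, bernstein_one,
      leading_one, sub_zero]
    rw [psumPow_eq_zero K (by omega) le_rfl, smul_zero, map_zero, sub_zero, map_sub,
      constantCoeff_leading le_rfl, constantCoeff_smul, constantCoeff_completeInt]
    split_ifs with h <;> simp [h]

/-- By `eq_zero_of_mode_lie`. The scalar has slope 1 in n because of the bracket with modes, and its
value is fixed by constant terms. -/
theorem leading_mul_bernstein (K : Type*) [Field K] [CharZero K] (r : ℤ) (hr : r ≠ 0) (n : ℤ) :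
    leading K r 1 * bernstein K n - bernstein K n * (leading K r 1 - mode K r) =
      ((n : K) + ((r : K) - 1) / 2) • bernstein K (n + r) := by
  have key := eq_zero_of_mode_lie (fun n => leading K r 1 * bernstein K n -
    bernstein K n * (leading K r 1 - mode K r) -
    ((n : K) + ((r : K) - 1) / 2) • bernstein K (n + r)) ?_ ?_ n
  · exact sub_eq_zero.mp key
  · intro s n hs
    have h1 : ⁅mode K s, leading K r 1⁆ = (-(s : K)) • mode K (r + s) := by
      have := mode_lie_leading K s r 0
      rw [leading_zero, zero_add] at this
      simpa using this
    have h2 := mode_lie_bernstein K s n hs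
    have h4 := mode_lie_bernstein K s (n + r) hs
    refine (comm_sub_mul_sub (A := Module.End K (SymFun K)) _ _ _ _ _ _).trans ?_
    rw [h1, h2, h4, mode_lie_mode, smul_mul_sub_mul_smul, mul_smul_comm,
      mul_one, add_right_comm n s r]
    -- When r + s = 0 the mode of index r + s is missing, and the central term of [`mode K s`, `mode
    -- K r`] supplies exactly the lost contribution.
    by_cases hrs : r + s = 0
    · rw [if_pos hrs, hrs, mode_zero, zero_mul, mul_zero, sub_zero, smul_zero, add_assoc n r s, hrs,
        add_zero]
      push_cast
      module
    · have h3 : mode K (r + s) * bernstein K n - bernstein K n * mode K (r + s) =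
        bernstein K (n + (r + s)) := mode_lie_bernstein K (r + s) n hrs
      rw [if_neg hrs, h3, add_assoc n r s]
      push_cast
      module
  · intro n
    simp only [LinearMap.sub_apply, Module.End.mul_apply, LinearMap.smul_apply, bernstein_one,
      leading_one, map_sub, map_smul, constantCoeff_smul, constantCoeff_completeInt, smul_eq_mul]
    induction r using int_cases_pnat with
    | pos i =>
      have hi := i.pos
      have hm : mode K ((i : ℕ) : ℤ) 1 = X i := by
        rw [mode_pos, LinearMap.mulLeft_apply, mul_one]
      have hb : bernstein K n (X i) = X i * completeInt K n - completeInt K (n + (i : ℕ)) := by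
        have := bernstein_X_mul K n i 1
        rwa [mul_one, bernstein_one, bernstein_one] at this
      rw [constantCoeff_leading (by omega), constantCoeff_bernstein_psumPow K n i hi, hm, hb,
        map_sub, map_mul, constantCoeff_X, zero_mul, constantCoeff_completeInt]
      split_ifs with h
      · have : (n : K) = -((i : ℕ) : K) := by
          rw [eq_neg_iff_add_eq_zero]; exact_mod_cast h
        rw [this]
        push_cast
        ring
      · ring
    | neg i =>
      have hi := i.pos
      rw [constantCoeff_leading_completeInt K i hi, psumPow_eq_zero K (by omega) (by omega), mode_neg,
        pPerp_one, map_zero, map_zero]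
      by_cases h : n = (i : ℕ)
      · rw [if_pos h, if_pos (by omega), h]
        push_cast
        ring
      · rw [if_neg h, if_neg (by omega)]
        ring
    | zero => exact absurd rfl hr

/-- Commutation of the cut-and-join operator with the Bernstein operators. -/
theorem cutJoin_mul_bernstein (K : Type*) [Field K] [CharZero K] (n : ℤ) :
    cutJoin K * bernstein K n = bernstein K n * (cutJoin K - leading K 0 1) +
      ((n : K) * ((n : K) - 1) / 2) • bernstein K n := by
  have key := eq_zero_of_mode_lie (fun n => cutJoin K * bernstein K n -
    bernstein K n * (cutJoin K - leading K 0 1) -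
    ((n : K) * ((n : K) - 1) / 2) • bernstein K n) ?_ ?_ n
  · rw [sub_sub, sub_eq_zero] at key
    exact key
  · intro s n hs
    have h1 : ⁅mode K s, leading K 0 1⁆ = (-(s : K)) • mode K s := by
      have := mode_lie_leading K s 0 0
      rw [leading_zero, zero_add, zero_add] at this
      simpa using this
    have h2 := mode_lie_bernstein K s n hs
    have h3 := leading_mul_bernstein K s hs n
    refine (comm_sub_mul_sub (A := Module.End K (SymFun K)) _ _ _ _ _ _).trans ?_
    -- The leftover term with `mode K s` is cancelled by the bracket of `mode K s` with the
    -- subtracted Euler operator.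
    have h4 : leading K s 1 * bernstein K n - bernstein K n * leading K s 1 =
        ((n : K) + ((s : K) - 1) / 2) • bernstein K (n + s) - bernstein K n * mode K s := by
      rw [← h3, mul_sub]
      abel
    rw [mode_lie_cutJoin, h1, h2, smul_mul_sub_mul_smul, h4, mul_smul_comm]
    push_cast
    module
  · intro n
    have h1 : cutJoin K 1 = 0 := by
      rw [cutJoin, LinearMap.smul_apply, leading_one, psumPow_eq_zero K (by omega) le_rfl, smul_zero,
        smul_zero]
    have h2 : ∀ f, constantCoeff (cutJoin K f) = 0 := by
      intro f
      rw [cutJoin, LinearMap.smul_apply, constantCoeff_smul, constantCoeff_leading le_rfl, smul_zero]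
    simp only [LinearMap.sub_apply, Module.End.mul_apply, LinearMap.smul_apply, bernstein_one,
      leading_one, h1]
    rw [psumPow_eq_zero K (by omega) le_rfl, smul_zero, sub_zero, map_zero, sub_zero, map_sub, h2,
      constantCoeff_smul, constantCoeff_completeInt]
    split_ifs with h <;> simp [h]

/-! ### The action on Jacobi–Trudi determinants -/

theorem completeInt_one (K : Type*) [Field K] [CharZero K] : completeInt K 1 = X 1 := by
  have h := smul_completeInt K 1 1 le_rfl
  rw [Int.cast_one, one_smul, Finset.sum_range_one, Nat.cast_zero, sub_self, sub_zero,
    completeInt_zero, mul_one] at h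
  exact h

theorem jacobiTrudi_congr (K : Type*) [Field K] (N : ℕ) {f g : ℕ → ℤ}
    (h : ∀ i < N, f i = g i) : jacobiTrudi K N f = jacobiTrudi K N g := by
  rw [jacobiTrudi, jacobiTrudi]
  congr 1
  ext1 i j
  rw [Matrix.of_apply, Matrix.of_apply, h i i.isLt]

/-- The innermost Bernstein operator has index 0 and fixes the vacuum, as h_0 = 1. -/
theorem jacobiTrudi_append_zero (K : Type*) [Field K] [CharZero K] (N : ℕ) (f : ℕ → ℤ)
    (h : f N = 0) : jacobiTrudi K (N + 1) f = jacobiTrudi K N f := by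
  induction N generalizing f with
  | zero =>
    rw [jacobiTrudi_succ, jacobiTrudi_zero, jacobiTrudi_zero, h, bernstein_one, completeInt_zero]
  | succ N ih => rw [jacobiTrudi_succ, ih _ h, ← jacobiTrudi_succ]

theorem jacobiTrudi_append_zeros (K : Type*) [Field K] [CharZero K] {M N : ℕ} (hMN : M ≤ N)
    (f : ℕ → ℤ) (h : ∀ i, M ≤ i → f i = 0) : jacobiTrudi K N f = jacobiTrudi K M f := by
  induction N, hMN using Nat.le_induction with
  | base => rfl
  | succ N hN ih => rw [jacobiTrudi_append_zero K N f (h N hN), ih]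

theorem jacobiTrudi_eq_zero (K : Type*) [Field K] {N i j : ℕ} (hi : i < N) (hj : j < N)
    (hij : i ≠ j) (f : ℕ → ℤ) (h : f i - i = f j - j) : jacobiTrudi K N f = 0 := by
  rw [jacobiTrudi]
  refine Matrix.det_zero_of_row_eq (i := ⟨i, hi⟩) (j := ⟨j, hj⟩) (by simpa using hij) ?_
  funext l
  simp [h]

theorem X_mul_bernstein (K : Type*) [Field K] (n : ℤ) (i : ℕ+) (f : SymFun K) :
    X i * bernstein K n f = bernstein K n (X i * f) + bernstein K (n + (i : ℕ)) f := by
  rw [bernstein_X_mul, sub_add_cancel]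

/-- The Pieri rule for multiplication by `p_1 = h_1`. -/
theorem X_one_mul_jacobiTrudi (K : Type*) [Field K] [CharZero K] (N : ℕ) (f : ℕ → ℤ)
    (h : f N = 0) : X 1 * jacobiTrudi K N f =
      ∑ i ∈ Finset.range (N + 1), jacobiTrudi K (N + 1) (f + Pi.single i 1) := by
  induction N generalizing f with
  | zero =>
    rw [Finset.sum_range_one, jacobiTrudi_succ, jacobiTrudi_zero, jacobiTrudi_zero, bernstein_one,
      Pi.add_apply, h, Pi.single_eq_same, zero_add, completeInt_one, mul_one]
  | succ N ih =>
    rw [jacobiTrudi_succ, X_mul_bernstein, ih _ h, map_sum, Finset.sum_range_succ' _ (N + 1)]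
    congr 1
    · refine Finset.sum_congr rfl fun i _ => ?_
      rw [jacobiTrudi_succ K (N + 1)]
      congr 1
      · rw [Pi.add_apply, Pi.single_eq_of_ne (by omega), add_zero]
      · congr 1
        funext j
        simp [Pi.single_apply]
    -- The cell in the first row comes from p_1 raising the outer Bernstein index; a zero row is
    -- appended to match sizes.
    · rw [jacobiTrudi_succ K (N + 1), jacobiTrudi_append_zero]
      · rw [Pi.add_apply, Pi.single_eq_same]
        congr 1
        exact jacobiTrudi_congr K N fun i _ => by simp
      · simpa using h

/-- B_{0,1} is the Euler operator, and each Bernstein operator adds its index to the eigenvalue. -/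
theorem leading_jacobiTrudi (K : Type*) [Field K] [CharZero K] (N : ℕ) (f : ℕ → ℤ) :
    leading K 0 1 (jacobiTrudi K N f) = (∑ i ∈ Finset.range N, (f i : K)) • jacobiTrudi K N f := by
  induction N generalizing f with
  | zero =>
    rw [jacobiTrudi_zero, leading_one, psumPow_eq_zero K (by omega) le_rfl]
    simp
  | succ N ih =>
    rw [jacobiTrudi_succ, ← Module.End.mul_apply, euler_mul_bernstein, LinearMap.add_apply,
      Module.End.mul_apply, ih, map_smul, LinearMap.smul_apply, ← add_smul, Finset.sum_range_succ']

/-- The sum of the contents of a diagram with rows `f`. -/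
noncomputable def contentSum (K : Type*) [Field K] (N : ℕ) (f : ℕ → ℤ) : K :=
  ∑ i ∈ Finset.range N, ((f i : K) * ((f i : K) - 1) / 2 - (i : K) * (f i : K))

/-- In the relation with the Bernstein operator, f_0(f_0-1)/2 is the content sum of the new first
row, and subtracting the Euler operator lowers the other contents by one as their rows move down. -/
theorem cutJoin_jacobiTrudi (K : Type*) [Field K] [CharZero K] (N : ℕ) (f : ℕ → ℤ) :
    cutJoin K (jacobiTrudi K N f) = contentSum K N f • jacobiTrudi K N f := by
  induction N generalizing f with
  | zero =>
    rw [jacobiTrudi_zero, cutJoin, LinearMap.smul_apply, leading_one,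
      psumPow_eq_zero K (by omega) le_rfl]
    simp [contentSum]
  | succ N ih =>
    rw [jacobiTrudi_succ, ← Module.End.mul_apply, cutJoin_mul_bernstein, LinearMap.add_apply,
      Module.End.mul_apply, LinearMap.sub_apply, ih, leading_jacobiTrudi, ← sub_smul, map_smul,
      LinearMap.smul_apply, ← add_smul]
    congr 1
    rw [contentSum, contentSum, Finset.sum_range_succ', ← Finset.sum_sub_distrib]
    congr 1
    · refine Finset.sum_congr rfl fun i _ => ?_
      push_cast
      ring
    · simp

theorem contentSum_add_single (K : Type*) [Field K] [CharZero K] (N : ℕ) (f : ℕ → ℤ) (i : ℕ)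
    (hi : i < N) :
    contentSum K N (f + Pi.single i 1) = contentSum K N f + ((f i : K) - (i : K)) := by
  rw [← sub_eq_iff_eq_add', contentSum, contentSum, ← Finset.sum_sub_distrib,
    Finset.sum_eq_single_of_mem i (Finset.mem_range.mpr hi)]
  · simp only [Pi.add_apply, Pi.single_eq_same]
    push_cast
    ring
  · intro j _ hj
    simp [Pi.single_eq_of_ne hj]

/-! ### Schur functions -/

/-- The row lengths of a Young diagram as integers. -/
def rows (lam : YoungDiagram) (i : ℕ) : ℤ := lam.rowLen i

theorem rowLen_eq_zero {lam : YoungDiagram} {i : ℕ} (h : lam.colLen 0 ≤ i) : lam.rowLen i = 0 := by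
  by_contra hne
  have h1 : (i, 0) ∈ lam := YoungDiagram.mem_iff_lt_rowLen.mpr (Nat.pos_of_ne_zero hne)
  have := YoungDiagram.mem_iff_lt_colLen.mp h1
  omega

/-- Zero rows are free, so λ and λ + □ can be compared at the same determinant size. -/
theorem schur_eq_jacobiTrudi (K : Type*) [Field K] [CharZero K] (lam : YoungDiagram) {N : ℕ}
    (h : lam.colLen 0 ≤ N) : schur K lam = jacobiTrudi K N (rows lam) := by
  rw [jacobiTrudi_append_zeros K h]
  · rfl
  · intro i hi
    simp [rows, rowLen_eq_zero hi]

theorem eq_rowLen_of_mem_addable {lam : YoungDiagram} {b : ℕ × ℕ} (hb : b ∈ addable lam) :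
    b.2 = lam.rowLen b.1 := by
  obtain ⟨h1, h2⟩ := (mem_addable lam b).mp hb
  obtain ⟨i, j⟩ := b
  have h3 : lam.rowLen i ≤ j := by
    by_contra hlt
    exact h1 (YoungDiagram.mem_iff_lt_rowLen.mpr (by simpa using hlt))
  rcases h3.eq_or_lt with h3 | h3
  · exact h3.symm
  · have h4 := h2 (a := (i, j)) (b := (i, lam.rowLen i)) (Prod.mk_le_mk.mpr ⟨le_rfl, h3.le⟩)
      (by simp)
    rcases Finset.mem_insert.mp (Finset.mem_coe.mp h4) with h5 | h5
    · exact (Prod.mk.inj h5).2.symm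
    · have := YoungDiagram.mem_iff_lt_rowLen.mp h5
      omega

theorem le_colLen_of_mem_addable {lam : YoungDiagram} {b : ℕ × ℕ} (hb : b ∈ addable lam) :
    b.1 ≤ lam.colLen 0 := by
  obtain ⟨h1, h2⟩ := (mem_addable lam b).mp hb
  obtain ⟨i, j⟩ := b
  by_contra hlt
  simp only [not_le] at hlt
  have h4 := h2 (a := (i, j)) (b := (lam.colLen 0, 0))
    (Prod.mk_le_mk.mpr ⟨hlt.le, Nat.zero_le _⟩) (by simp)
  rcases Finset.mem_insert.mp (Finset.mem_coe.mp h4) with h5 | h5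
  · have := (Prod.mk.inj h5).1
    omega
  · have := YoungDiagram.mem_iff_lt_colLen.mp h5
    omega

theorem mem_addable_of_lt {lam : YoungDiagram} {i : ℕ}
    (h : ∀ a < i, lam.rowLen i < lam.rowLen a) : (i, lam.rowLen i) ∈ addable lam := by
  rw [mem_addable]
  refine ⟨fun hm => lt_irrefl _ (YoungDiagram.mem_iff_lt_rowLen.mp hm), ?_⟩
  rintro x ⟨a, b⟩ hle hx
  rcases Finset.mem_insert.mp (Finset.mem_coe.mp hx) with rfl | hx
  · obtain ⟨ha, hb⟩ := Prod.mk_le_mk.mp hle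
    rw [Finset.mem_coe, Finset.mem_insert]
    rcases ha.eq_or_lt with rfl | ha
    · rcases hb.eq_or_lt with rfl | hb
      · exact Or.inl rfl
      · exact Or.inr (YoungDiagram.mem_iff_lt_rowLen.mpr hb)
    · exact Or.inr (YoungDiagram.mem_iff_lt_rowLen.mpr (hb.trans_lt (h a ha)))
  · exact Finset.mem_coe.mpr (Finset.mem_insert_of_mem (lam.isLowerSet hle hx))

theorem mem_addCell {lam : YoungDiagram} {b : ℕ × ℕ} (hb : b ∈ addable lam) (c : ℕ × ℕ) :
    c ∈ addCell lam b hb ↔ c = b ∨ c ∈ lam :=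
  Finset.mem_insert

theorem rows_addCell {lam : YoungDiagram} {b : ℕ × ℕ} (hb : b ∈ addable lam) :
    rows (addCell lam b hb) = rows lam + Pi.single b.1 1 := by
  have h2 := eq_rowLen_of_mem_addable hb
  obtain ⟨i, j⟩ := b
  simp only at h2
  subst h2
  funext a
  have key : ∀ c, c < (addCell lam (i, lam.rowLen i) hb).rowLen a ↔
      (a = i ∧ c = lam.rowLen i) ∨ c < lam.rowLen a := fun c => by
    rw [← YoungDiagram.mem_iff_lt_rowLen, mem_addCell, YoungDiagram.mem_iff_lt_rowLen,
      Prod.mk.injEq]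
  rw [Pi.add_apply, rows, rows]
  rcases eq_or_ne a i with rfl | hne
  · have : (addCell lam (a, lam.rowLen a) hb).rowLen a = lam.rowLen a + 1 :=
      eq_of_forall_lt_iff fun c => by rw [key]; omega
    rw [this, Pi.single_eq_same]
    push_cast
    rfl
  · have : (addCell lam (i, lam.rowLen i) hb).rowLen a = lam.rowLen a :=
      eq_of_forall_lt_iff fun c => by rw [key]; simp [hne]
    rw [this, Pi.single_eq_of_ne hne, add_zero]

theorem colLen_addCell_le {lam : YoungDiagram} {b : ℕ × ℕ} (hb : b ∈ addable lam) :
    (addCell lam b hb).colLen 0 ≤ lam.colLen 0 + 1 := by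
  by_contra h
  rw [not_le, ← YoungDiagram.mem_iff_lt_colLen, mem_addCell] at h
  rcases h with h | h
  · have := le_colLen_of_mem_addable hb
    rw [← h] at this
    simp at this
  · have := YoungDiagram.mem_iff_lt_colLen.mp h
    omega

theorem schur_addCell (K : Type*) [Field K] [CharZero K] {lam : YoungDiagram} {b : ℕ × ℕ}
    (hb : b ∈ addable lam) : schur K (addCell lam b hb) =
      jacobiTrudi K (lam.colLen 0 + 1) (rows lam + Pi.single b.1 1) := by
  rw [schur_eq_jacobiTrudi K _ (colLen_addCell_le hb), rows_addCell]

/-- The Pieri sum over all rows reduces to the addable ones: elsewhere the determinant has two equal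
rows. -/
theorem X_one_mul_schur (K : Type*) [Field K] [CharZero K] (lam : YoungDiagram) :
    X 1 * schur K lam = ∑ b ∈ (addable lam).attach, schur K (addCell lam b.1 b.2) := by
  rw [schur_eq_jacobiTrudi K lam le_rfl, X_one_mul_jacobiTrudi]
  · have hG : ∑ b ∈ (addable lam).attach, schur K (addCell lam b.1 b.2) =
        ∑ b ∈ addable lam, jacobiTrudi K (lam.colLen 0 + 1) (rows lam + Pi.single b.1 1) := by
      rw [← Finset.sum_attach (addable lam)]
      exact Finset.sum_congr rfl fun b _ => schur_addCell K b.2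
    rw [hG]
    refine (Finset.sum_of_injOn Prod.fst ?_ ?_ ?_ fun _ _ => rfl).symm
    · intro b hb c hc hbc
      refine Prod.ext hbc ?_
      rw [eq_rowLen_of_mem_addable hb, eq_rowLen_of_mem_addable hc, hbc]
    · intro b hb
      exact Finset.mem_coe.mpr (Finset.mem_range.mpr
        (Nat.lt_succ_of_le (le_colLen_of_mem_addable hb)))
    · intro i hi hni
      rw [Finset.mem_range] at hi
      have : ∃ a < i, lam.rowLen a ≤ lam.rowLen i := by
        by_contra hne
        push Not at hne
        exact hni ⟨_, mem_addable_of_lt hne, rfl⟩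
      obtain ⟨a, hai, ha⟩ := this
      -- Monotonicity forces rows i - 1 and i to have equal length; after adding the cell, λ_i + 1 -
      -- i = λ_{i-1} - (i - 1).
      have h1 := lam.rowLen_anti (i - 1) i (by omega)
      have h2 := lam.rowLen_anti a (i - 1) (by omega)
      refine jacobiTrudi_eq_zero K (i := i - 1) (j := i) (by omega) hi (by omega) _ ?_
      rw [Pi.add_apply, Pi.add_apply, Pi.single_eq_same, Pi.single_eq_of_ne (by omega), rows, rows]
      omega
  · simp [rows, rowLen_eq_zero le_rfl]

/-- The eigenvalues of `cutJoin` at λ + □ and λ differ by c(□), so each commutator contributes one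
more factor c(□). -/
theorem isUFamily_contentOp (K : Type*) [Field K] [CharZero K] : IsUFamily K (contentOp K) := by
  intro k lam
  induction k with
  | zero =>
    rw [contentOp, LinearMap.mulLeft_apply, X_one_mul_schur]
    simp
  | succ k ih =>
    rw [contentOp, Ring.lie_def, LinearMap.sub_apply, Module.End.mul_apply, Module.End.mul_apply,
      ih, map_sum]
    have h1 : cutJoin K (schur K lam) =
        contentSum K (lam.colLen 0 + 1) (rows lam) • schur K lam := by
      rw [schur_eq_jacobiTrudi K lam (Nat.le_succ _), cutJoin_jacobiTrudi]
    rw [h1, map_smul, ih, Finset.smul_sum, ← Finset.sum_sub_distrib]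
    refine Finset.sum_congr rfl fun b _ => ?_
    have hb := le_colLen_of_mem_addable b.2
    rw [map_smul, schur_addCell, cutJoin_jacobiTrudi, contentSum_add_single K _ _ _ (by omega),
      content, eq_rowLen_of_mem_addable b.2, rows]
    push_cast
    rw [pow_succ]
    module

/-! ### The Schur functions span. -/

/-- Straightening: sorting the numbers f_i - i gives, up to sign, a Schur function, or 0 if two
coincide or a row vanishes. -/
theorem jacobiTrudi_mem_span_schur (K : Type*) [Field K] [CharZero K] (N : ℕ) (f : ℕ → ℤ) :
    jacobiTrudi K N f ∈ Submodule.span K (Set.range (schur K)) := by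
  cases N with
  | zero =>
    refine Submodule.subset_span ⟨⊥, ?_⟩
    have h : (⊥ : YoungDiagram).colLen 0 ≤ 0 := by
      by_contra h
      exact YoungDiagram.notMem_bot _ (YoungDiagram.mem_iff_lt_colLen.mpr (not_le.mp h))
    rw [schur_eq_jacobiTrudi K _ h, jacobiTrudi_zero, jacobiTrudi_zero]
  | succ N =>
    by_cases hinj : Function.Injective fun i : Fin (N + 1) => (i : ℤ) - f i
    · set g : Fin (N + 1) → ℤ := fun i => (i : ℤ) - f i with hg
      set σ := Tuple.sort g
      have hmono : StrictMono (g ∘ σ) :=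
        (Tuple.monotone_sort g).strictMono_of_injective (hinj.comp σ.injective)
      have hdet : jacobiTrudi K (N + 1) f = ((Equiv.Perm.sign σ : ℤ) : K) •
          Matrix.det (Matrix.of fun i j : Fin (N + 1) =>
            completeInt K (-(g (σ i)) + (j : ℤ))) := by
        have h1 := Matrix.det_permute σ (Matrix.of fun i j : Fin (N + 1) =>
            completeInt K (f i - (i : ℤ) + (j : ℤ)))
        have h2 : (Matrix.of fun i j : Fin (N + 1) => completeInt K (-(g (σ i)) + (j : ℤ))) =
            (Matrix.of fun i j : Fin (N + 1) =>
              completeInt K (f i - (i : ℤ) + (j : ℤ))).submatrix σ id := by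
          ext1 i j
          simp [hg]
        rw [h2, h1, jacobiTrudi]
        rcases Int.units_eq_one_or (Equiv.Perm.sign σ) with h | h <;> simp [h]
      rw [hdet]
      refine Submodule.smul_mem _ _ ?_
      set l : Fin (N + 1) → ℤ := fun i => (i : ℤ) - g (σ i) with hl
      -- Strictly increasing integers grow by at least 1, so removing the staircase leaves a weakly
      -- decreasing sequence.
      have hanti : Antitone l := by
        rw [Fin.antitone_iff_succ_le]
        intro i
        have : g (σ i.castSucc) < g (σ i.succ) := hmono (Fin.castSucc_lt_succ)
        simp only [hl, Fin.val_succ, Fin.val_castSucc]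
        push_cast
        omega
      -- If the last part is negative, every h in the last row has negative index.
      by_cases hlast : l (Fin.last N) < 0
      · rw [Matrix.det_eq_zero_of_row_eq_zero (Fin.last N)]
        · exact zero_mem _
        · intro j
          have hj : (j : ℕ) ≤ N := Nat.lt_succ_iff.mp j.isLt
          simp only [hl, Fin.val_last] at hlast
          rw [Matrix.of_apply, completeInt_of_neg K (by omega)]
      · have hpos : ∀ i, 0 ≤ l i := fun i => (not_lt.mp hlast).trans (hanti (Fin.le_last i))
        have hs : (List.ofFn fun i => (l i).toNat).SortedGE := by
          rw [List.sortedGE_ofFn_iff]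
          exact fun i j hij => Int.toNat_le_toNat (hanti hij)
        refine Submodule.subset_span ⟨YoungDiagram.ofRowLens _ hs, ?_⟩
        have hcol : (YoungDiagram.ofRowLens _ hs).colLen 0 ≤ N + 1 := by
          by_contra h
          rw [not_le, ← YoungDiagram.mem_iff_lt_colLen, YoungDiagram.mem_ofRowLens] at h
          obtain ⟨h, -⟩ := h
          simp at h
        rw [schur_eq_jacobiTrudi K _ hcol, jacobiTrudi]
        congr 1
        ext1 i j
        have h3 : rows (YoungDiagram.ofRowLens _ hs) i = l i := by
          have := YoungDiagram.rowLen_ofRowLens (hw := hs) (i.cast (by simp))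
          simp only [Fin.val_cast] at this
          rw [rows, this, Fin.getElem_fin, List.getElem_ofFn]
          exact Int.toNat_of_nonneg (hpos i)
        rw [Matrix.of_apply, Matrix.of_apply, h3]
        congr 1
        simp only [hl]
        ring
    · rw [Function.Injective] at hinj
      push Not at hinj
      obtain ⟨i, j, hij, hne⟩ := hinj
      rw [jacobiTrudi_eq_zero K i.isLt j.isLt (fun h => hne (Fin.ext h)) f (by omega)]
      exact zero_mem _

/-- The span of the Jacobi–Trudi determinants contains 1 and is stable under Bernstein operators, so
it contains every h_n. Newton's identity then puts the p_n in it, and multiplication by them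
preserves it. -/
theorem span_schur (K : Type*) [Field K] [CharZero K] :
    Submodule.span K (Set.range (schur K)) = ⊤ := by
  set S := Submodule.span K (Set.range fun x : ℕ × (ℕ → ℤ) => jacobiTrudi K x.1 x.2) with hS
  have hone : (1 : SymFun K) ∈ S :=
    Submodule.subset_span ⟨(0, fun _ => 0), jacobiTrudi_zero K _⟩
  have hbern : ∀ (n : ℤ) (f : SymFun K), f ∈ S → bernstein K n f ∈ S := by
    intro n f hf
    induction hf using Submodule.span_induction with
    | mem x hx =>
      obtain ⟨⟨N, f⟩, rfl⟩ := hx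
      refine Submodule.subset_span ⟨(N + 1, fun i => Nat.casesOn i n f), ?_⟩
      exact jacobiTrudi_succ K N _
    | zero => rw [map_zero]; exact zero_mem _
    | add x y _ _ hx hy => rw [map_add]; exact add_mem hx hy
    | smul a x _ hx => rw [map_smul]; exact Submodule.smul_mem _ _ hx
  -- Only p_i · 1 needs the hypothesis; beyond that, p_i moves past the Bernstein operators one at a
  -- time.
  have hclosed : ∀ i : ℕ+, X i ∈ S → ∀ f ∈ S, X i * f ∈ S := by
    intro i hi f hf
    induction hf using Submodule.span_induction with
    | mem x hx =>
      obtain ⟨⟨N, f⟩, rfl⟩ := hx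
      simp only
      induction N generalizing f with
      | zero => rwa [jacobiTrudi_zero, mul_one]
      | succ N ih =>
        rw [jacobiTrudi_succ, X_mul_bernstein]
        exact add_mem (hbern _ _ (ih _)) (hbern _ _ (Submodule.subset_span ⟨(N, _), rfl⟩))
    | zero => rw [mul_zero]; exact zero_mem _
    | add x y _ _ hx hy => rw [mul_add]; exact add_mem hx hy
    | smul a x _ hx => rw [mul_smul_comm]; exact Submodule.smul_mem _ _ hx
  have hcomplete : ∀ n, completeInt K n ∈ S := by
    intro n
    rw [← bernstein_one]
    exact hbern n 1 hone
  have hX : ∀ n : ℕ, (X (Nat.succPNat n) : SymFun K) ∈ S := by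
    intro n
    induction n using Nat.strong_induction_on with
    | _ n ih =>
      have h := smul_completeInt K (n + 1 : ℕ) (n + 1) le_rfl
      rw [Finset.sum_range_succ, show ((n + 1 : ℕ) : ℤ) - 1 - n = 0 by push_cast; ring,
        completeInt_zero, mul_one, ← sub_eq_iff_eq_add'] at h
      rw [← h]
      refine sub_mem (Submodule.smul_mem _ _ (hcomplete _)) (Submodule.sum_mem _ fun j hj => ?_)
      exact hclosed _ (ih j (Finset.mem_range.mp hj)) _ (hcomplete _)
  have hX' : ∀ i : ℕ+, (X i : SymFun K) ∈ S := by
    intro i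
    rw [← PNat.succPNat_natPred i]
    exact hX _
  have htop : S = ⊤ := by
    rw [eq_top_iff]
    intro f _
    induction f using MvPolynomial.induction_on with
    | C r =>
      have : (C r : SymFun K) = r • 1 := by rw [smul_eq_C_mul, mul_one]
      rw [this]
      exact Submodule.smul_mem _ _ hone
    | add p q hp hq => exact add_mem (hp trivial) (hq trivial)
    | mul_X p i hp => rw [mul_comm]; exact hclosed i (hX' i) p (hp trivial)
  rw [eq_top_iff, ← htop, hS, Submodule.span_le]
  rintro _ ⟨⟨N, f⟩, rfl⟩
  exact jacobiTrudi_mem_span_schur K N f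

theorem eq_contentOp_of_isUFamily (K : Type*) [Field K] [CharZero K]
    (U : ℕ → Module.End K (SymFun K)) (hU : IsUFamily K U) : U = contentOp K := by
  funext k
  refine LinearMap.ext_on_range (span_schur K) fun lam => ?_
  rw [hU k lam, isUFamily_contentOp K k lam]

/-! ### Sums over tuples of positive integers -/

/-- The partition with parts `b_1, …, b_m`. -/
noncomputable def tuplePart {m : ℕ} (b : Fin m → ℕ+) : Part := ∑ i, Finsupp.single (b i) 1

theorem degree_tuplePart {m : ℕ} (b : Fin m → ℕ+) : (tuplePart b).degree = m := by
  simp [tuplePart, map_sum]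

theorem size_tuplePart {m : ℕ} (b : Fin m → ℕ+) : size (tuplePart b) = ∑ i, (b i : ℕ) := by
  simp [tuplePart, size, map_sum, Finsupp.weight_single]

theorem tuples_finite (j n : ℕ) : {a : Fin j → ℕ+ | ∑ i, (a i : ℕ) = n}.Finite := by
  have h1 : {x : ℕ+ | (x : ℕ) ≤ n}.Finite :=
    (Set.finite_Iic n).preimage (fun a _ b _ h => PNat.coe_injective h)
  refine (Set.Finite.pi' (ι := Fin j) fun _ => h1).subset fun a ha i => ?_
  rw [Set.mem_ofPred_eq] at ha ⊢
  rw [← ha]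
  exact Finset.single_le_sum (f := fun i => (a i : ℕ)) (fun _ _ => Nat.zero_le _)
    (Finset.mem_univ i)

/-- The tuples of `j` positive integers with sum `n`. -/
noncomputable def tuples (j n : ℕ) : Finset (Fin j → ℕ+) := (tuples_finite j n).toFinset

theorem mem_tuples {j n : ℕ} {a : Fin j → ℕ+} : a ∈ tuples j n ↔ ∑ i, (a i : ℕ) = n := by
  simp [tuples]

theorem psumPow_eq_sum_tuples (K : Type*) [Field K] (j n : ℕ) :
    psumPow K j n = ∑ a ∈ tuples j n, ∏ i, (X (a i) : SymFun K) := by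
  have h1 : psumSeries K ^ j = ∏ _i : Fin j, psumSeries K := by simp
  rw [psumPow, if_pos (by omega), Int.toNat_natCast, h1, PowerSeries.coeff_prod]
  symm
  refine Finset.sum_of_injOn
    (fun a => Finsupp.equivFunOnFinite.symm fun i => (a i : ℕ)) ?_ ?_ ?_ ?_
  · intro a _ b _ hab
    funext i
    exact PNat.coe_injective (congrFun (Finsupp.equivFunOnFinite.symm.injective hab) i)
  · intro a ha
    rw [Finset.mem_coe, mem_tuples] at ha
    rw [Finset.mem_coe, Finset.mem_finsuppAntidiag]
    exact ⟨ha, Finset.subset_univ _⟩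
  · intro l hl hni
    rw [Finset.mem_finsuppAntidiag] at hl
    by_cases hpos : ∀ i, 0 < l i
    · refine absurd ⟨fun i => (l i).toPNat (hpos i), ?_, ?_⟩ hni
      · rw [Finset.mem_coe, mem_tuples]
        exact hl.1
      · ext i
        rfl
    -- Compositions with a zero part drop out because the generating series has no constant term.
    · push Not at hpos
      obtain ⟨i, hi⟩ := hpos
      refine Finset.prod_eq_zero (Finset.mem_univ i) ?_
      rw [psumSeries, PowerSeries.coeff_mk, dif_neg (by omega)]
  · intro a _
    refine Finset.prod_congr rfl fun i _ => ?_
    rw [psumSeries, PowerSeries.coeff_mk, dif_pos (by simp)]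
    congr 1

theorem prod_X_eq_monomial (K : Type*) [Field K] {m : ℕ} (b : Fin m → ℕ+) :
    ∏ i, (X (b i) : SymFun K) = monomial (tuplePart b) 1 := by
  rw [tuplePart, monomial_sum_one]
  rfl

theorem arrangements_eq_sum (K : Type*) [Field K] (α : Part) :
    arrangements K α =
      ∑ b ∈ tuples α.degree (size α), if tuplePart b = α then (1 : K) else 0 := by
  rw [arrangements, psumPow_eq_sum_tuples, coeff_sum]
  refine Finset.sum_congr rfl fun b _ => ?_
  rw [prod_X_eq_monomial, coeff_monomial]

theorem pPerpPart_tuplePart (K : Type*) [Field K] {m : ℕ} (b : Fin m → ℕ+) :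
    (List.ofFn fun i => pPerp K (b i)).prod = pPerpPart K (tuplePart b) := by
  induction m with
  | zero => simp [tuplePart, pPerpPart_zero]
  | succ m ih =>
    rw [List.ofFn_succ, List.prod_cons, ih fun i => b i.succ]
    have : tuplePart b = tuplePart (fun i => b i.succ) + Finsupp.single (b 0) 1 := by
      rw [tuplePart, tuplePart, Fin.sum_univ_succ, add_comm]
    rw [this, pPerpPart_add_single, (pPerpPart_commute K _ _).eq]

theorem term_apply (K : Type*) [Field K] {j m : ℕ} (t : (Fin j → ℕ+) × (Fin m → ℕ+))
    (f : SymFun K) :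
    term K t f = (∏ i, X (t.1 i)) * pPerpPart K (tuplePart t.2) f := by
  rw [term, Module.End.mul_apply, LinearMap.mulLeft_apply, pPerpPart_tuplePart]

theorem tuplePart_fiber_finite (m : ℕ) (α : Part) :
    ((tuplePart : (Fin m → ℕ+) → Part) ⁻¹' {α}).Finite := by
  refine (tuples_finite m (size α)).subset fun b hb => ?_
  rw [Set.mem_preimage, Set.mem_singleton_iff] at hb
  rw [Set.mem_ofPred_eq, ← size_tuplePart, hb]

/-- A sum over tuples of a function of the underlying partition, grouped by the partition. -/
theorem finsum_tuplePart (K : Type*) [Field K] (m : ℕ) (g : Part → SymFun K)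
    (hg : (Function.support g).Finite) :
    ∑ᶠ b : Fin m → ℕ+, g (tuplePart b) =
      ∑ᶠ α : Part, (if α.degree = m then arrangements K α else 0) • g α := by
  classical
  -- `H` lives on the graph of `tuplePart`; summing it in the two orders gives the two sides.
  set H : Part × (Fin m → ℕ+) → SymFun K :=
    fun x => if tuplePart x.2 = x.1 then g x.1 else 0 with hH
  have hfin : (Function.support H).Finite := by
    have h1 : ((tuplePart : (Fin m → ℕ+) → Part) ⁻¹' Function.support g).Finite :=
      hg.preimage' fun α _ => tuplePart_fiber_finite m α
    refine (h1.image fun b => (tuplePart b, b)).subset ?_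
    rintro ⟨α, b⟩ hx
    have hb : tuplePart b = α := by
      by_contra hne
      exact hx (if_neg hne)
    subst hb
    refine ⟨b, ?_, rfl⟩
    simpa [hH] using hx
  have hfin' : (Function.support (H ∘ Prod.swap)).Finite :=
    hfin.preimage Prod.swap_injective.injOn
  have e1 : ∑ᶠ x, H x = ∑ᶠ α : Part, (if α.degree = m then arrangements K α else 0) • g α := by
    rw [finsum_curry H hfin]
    refine finsum_congr fun α => ?_
    by_cases hα : α.degree = m
    · subst hα
      rw [if_pos rfl, arrangements_eq_sum, Finset.sum_smul,
        finsum_eq_sum_of_support_subset (s := tuples α.degree (size α))]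
      · refine Finset.sum_congr rfl fun b _ => ?_
        simp [hH]
      · intro b hb
        have : tuplePart b = α := by
          by_contra hne
          exact hb (if_neg hne)
        rw [Finset.mem_coe, mem_tuples, ← size_tuplePart, this]
    · rw [if_neg hα, zero_smul]
      refine (finsum_congr fun b => if_neg fun h => hα ?_).trans finsum_zero
      rw [← degree_tuplePart b]
      exact congrArg _ h.symm
  have e2 : ∑ᶠ x, (H ∘ Prod.swap) x = ∑ᶠ b : Fin m → ℕ+, g (tuplePart b) := by
    rw [finsum_curry _ hfin']
    refine finsum_congr fun b => ?_
    rw [finsum_eq_single _ (tuplePart b)]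
    · simp [hH]
    · intro α hα
      exact if_neg hα.symm
  rw [← e2, ← e1]
  exact finsum_comp_equiv (Equiv.prodComm _ _) (f := H)

/-- For fixed b the sum over a is a coefficient of P(z)^j; the b's are then grouped by their
underlying partition. -/
theorem balancedSum_eq_normalOp (K : Type*) [Field K] (j m : ℕ) :
    balancedSum K j m = normalOp K fun α =>
      (if α.degree = m then arrangements K α else 0) • psumPow K j (1 + size α) := by
  classical
  refine LinearMap.ext fun f => ?_
  set g : Part → SymFun K := fun α => psumPow K j (1 + size α) * pPerpPart K α f with hg
  have h1 : normalOp K (fun α =>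
      (if α.degree = m then arrangements K α else 0) • psumPow K j (1 + size α)) f =
      ∑ᶠ b : Fin m → ℕ+, g (tuplePart b) := by
    rw [finsum_tuplePart K m g (normal_finite K _ f), normalOp_apply]
    exact finsum_congr fun α => smul_mul_assoc _ _ _
  set F : (Fin m → ℕ+) × (Fin j → ℕ+) → SymFun K := fun x =>
    if x.swap ∈ balanced j m then term K x.swap f else 0 with hF
  have hfin : (Function.support F).Finite := by
    refine ((term_finite K j m f).image fun t => t.1.swap).subset fun x hx => ?_
    have hb : x.swap ∈ balanced j m := by
      by_contra hne
      exact hx (if_neg hne)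
    refine ⟨⟨x.swap, hb⟩, ?_, Prod.swap_swap x⟩
    have : F x = term K x.swap f := if_pos hb
    rw [Function.mem_support, this] at hx
    exact hx
  have h2 : balancedSum K j m f = ∑ᶠ x, F x := by
    change ∑ᶠ t : balanced j m, term K t.1 f = _
    rw [finsum_set_coe_eq_finsum_mem (balanced j m) (f := fun t => term K t f), finsum_mem_def,
      ← finsum_comp_equiv (Equiv.prodComm _ _)]
    refine finsum_congr fun x => ?_
    rw [Set.indicator_apply]
    rfl
  rw [h1, h2, finsum_curry F hfin]
  refine finsum_congr fun b => ?_
  have hs : (1 : ℤ) + (size (tuplePart b) : ℤ) = ((∑ i, (b i : ℕ) + 1 : ℕ) : ℤ) := by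
    rw [size_tuplePart]; push_cast; ring
  simp only [hg]
  rw [hs, psumPow_eq_sum_tuples, Finset.sum_mul,
    finsum_eq_sum_of_support_subset (s := tuples j (∑ i, (b i : ℕ) + 1))]
  · refine Finset.sum_congr rfl fun a ha => ?_
    have hab : (a, b) ∈ balanced j m := mem_tuples.mp ha
    exact (if_pos hab).trans (term_apply K (a, b) f)
  · intro a ha
    have hab : (a, b) ∈ balanced j m := by
      by_contra hne
      exact ha (if_neg hne)
    exact Finset.mem_coe.mpr (mem_tuples.mpr hab)

theorem normalOp_sum (K : Type*) [Field K] {ι : Type*} (s : Finset ι) (c : ι → Part → SymFun K) :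
    ∑ i ∈ s, normalOp K (c i) = normalOp K (∑ i ∈ s, c i) := by
  classical
  induction s using Finset.induction_on with
  | empty => rw [Finset.sum_empty, Finset.sum_empty, normalOp_zero]
  | insert a s ha ih => rw [Finset.sum_insert ha, Finset.sum_insert ha, ih, normalOp_add]

/-! ### The binomial expansion and the top degree part. -/

/-- Binomial theorem for φ^N; at a given α only j = N - l(α) contributes. -/
theorem normalPow_one_eq_sum (K : Type*) [Field K] (N : ℕ) :
    normalPow K 1 N =
      ∑ j ∈ Finset.range (N + 1), (N.choose j : K) • balancedSum K j (N - j) := by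
  simp only [balancedSum_eq_normalOp, smul_normalOp]
  rw [normalOp_sum, normalPow]
  congr 1
  funext α
  rw [Finset.sum_apply]
  by_cases h : α.degree ≤ N
  · rw [Finset.sum_eq_single (N - α.degree)]
    · rw [if_pos (by omega), smul_smul, Nat.choose_symm h]
    · intro j hj hne
      rw [Finset.mem_range] at hj
      rw [if_neg (by omega), zero_smul, smul_zero]
    · intro hn
      exact absurd (Finset.mem_range.mpr (by omega)) hn
  · rw [Nat.choose_eq_zero_of_lt (by omega), Nat.cast_zero, zero_mul, zero_smul]
    refine (Finset.sum_eq_zero fun j hj => ?_).symm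
    rw [if_neg (by omega), zero_smul, smul_zero]

theorem psumPow_eq_zero_of_lt (K : Type*) [Field K] {j n : ℕ} (h : n < j) :
    psumPow K j n = 0 := by
  rw [psumPow_eq_sum_tuples]
  refine Finset.sum_eq_zero fun a ha => ?_
  have h1 := mem_tuples.mp ha
  have h2 : ∑ _i : Fin j, 1 ≤ ∑ i, (a i : ℕ) := Finset.sum_le_sum fun i _ => (a i).pos
  simp at h2
  omega

theorem balancedSum_zero_left (K : Type*) [Field K] (m : ℕ) : balancedSum K 0 m = 0 := by
  rw [balancedSum_eq_normalOp, ← normalOp_zero]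
  congr 1
  funext α
  rw [psumPow_zero, if_neg (show ¬((1 : ℤ) + size α = 0) by omega), smul_zero]
  rfl

theorem balancedSum_zero_right (K : Type*) [Field K] {j : ℕ} (hj : 1 < j) :
    balancedSum K j 0 = 0 := by
  rw [balancedSum_eq_normalOp, ← normalOp_zero]
  congr 1
  funext α
  split_ifs with h
  · rw [(Finsupp.degree_eq_zero_iff α).mp h, size_zero]
    have := psumPow_eq_zero_of_lt K hj
    rw [Nat.cast_one] at this
    rw [Nat.cast_zero, add_zero, this, smul_zero]
    rfl
  · rw [zero_smul]
    rfl

/-- The term j = 0 would need 0 = ∑ b + 1. The term j = k + 1 would need k + 1 ≥ 2 positive integers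
with sum 1, which is where k ≥ 1 enters. -/
theorem leading_one_eq_sum (K : Type*) [Field K] (k : ℕ) (hk : 1 ≤ k) :
    leading K 1 k = ∑ j ∈ Finset.Icc 1 k,
      ((1 / ((k : K) + 1)) * ((k + 1).choose j : K)) • balancedSum K j (k + 1 - j) := by
  rw [leading, normalPow_one_eq_sum, Finset.sum_range_succ, Nat.sub_self,
    balancedSum_zero_right K (by omega), smul_zero, add_zero, Finset.smul_sum]
  symm
  refine Finset.sum_subset_zero_on_sdiff (fun j hj => ?_) (fun j hj => ?_) fun j _ => ?_
  · rw [Finset.mem_Icc] at hj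
    exact Finset.mem_range.mpr (by omega)
  · rw [Finset.mem_sdiff, Finset.mem_range, Finset.mem_Icc] at hj
    obtain rfl : j = 0 := by omega
    rw [balancedSum_zero_left, smul_zero, smul_zero]
  · rw [smul_smul, one_div, Nat.cast_add, Nat.cast_one]

/-- B_{1,k} is homogeneous of total degree k + 1, and the difference from it has no terms of that
degree. -/
theorem genusPart_contentOp (K : Type*) [Field K] [CharZero K] (k : ℕ) :
    genusPart K k 0 (contentOp K k) = leading K 1 k := by
  rw [genusPart, if_pos (by omega), Nat.mul_zero, Nat.sub_zero,
    ← add_sub_cancel (leading K 1 k) (contentOp K k), degreePart_add,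
    degreePart_eq_zero (contentOp_sub_leading_mem K k) le_rfl, add_zero,
    leading, degreePart_smul, degreePart_normalPow]

end ContentOps

theorem corollary5p6 (K : Type*) [Field K] [CharZero K] :
    (∃! U : ℕ → Module.End K (ContentOps.SymFun K), ContentOps.IsUFamily K U) ∧
    ∀ U : ℕ → Module.End K (ContentOps.SymFun K), ContentOps.IsUFamily K U →
      ContentOps.genusPart K 0 0 (U 0) = LinearMap.mulLeft K (MvPolynomial.X 1) ∧
      ∀ k : ℕ, 1 ≤ k →
        ContentOps.genusPart K k 0 (U k) =
          ∑ j ∈ Finset.Icc 1 k,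
            ((1 / ((k : K) + 1)) * ((k + 1).choose j : K)) •
              ContentOps.balancedSum K j (k + 1 - j) := by
  refine ⟨⟨ContentOps.contentOp K, ContentOps.isUFamily_contentOp K,
    ContentOps.eq_contentOp_of_isUFamily K⟩, fun U hU => ?_⟩
  rw [ContentOps.eq_contentOp_of_isUFamily K U hU]
  refine ⟨?_, fun k hk => ?_⟩
  · rw [ContentOps.genusPart_contentOp, ContentOps.leading_zero]
    exact ContentOps.mode_pos K 1
  · rw [ContentOps.genusPart_contentOp, ContentOps.leading_one_eq_sum K k hk]
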